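/- Let $F$ be a finite field and let $n \ge 2$ be an integer. For a bilinear form $f$ on a finite-dimensional $F$-vector space $V$, let $G(V,f)$ be the group of invertible linear maps $g\colon V\to V$ with $f(g(u),g(v))=f(u,v)$ for all $u,v\in V$; it is the orthogonal group $\mathrm{O}(V,f)$ if $f$ is symmetric and nonsingular, and the symplectic group $\mathrm{Sp}(V,f)$ if $f$ is symplectic, that is, alternating and nonsingular. For a quadratic form $Q$ on $V$ with polar form $f_Q(u,v)=Q(u+v)-Q(u)-Q(v)$, let $\mathrm{O}(V,Q)$ be the group of invertible linear maps $g\colon V\to V$ with $Q(g(v))=Q(v)$ for all $v\in V$; call $Q$ nonsingular if the only $v\in V$ with $Q(v)=0$ and $f_Q(u,v)=0$ for all $u\in V$ is $v=0$. Say that $f$ (respectively $Q$) is of plus type if there is a subspace $W\subseteq V$ of dimension $\frac12\dim V$ with $f(u,w)=0$ for all $u,w\in W$ (respectively $Q(w)=0$ for all $w\in W$), and of minus type otherwise. 1. If $\operatorname{char}F$ is odd and $n$ is odd, there is, up to isomorphism, exactly one group $\mathrm{O}(n)$ of the form $\mathrm{O}(V,f)$ with $\dim V=n$ and $f$ a nonsingular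 symmetric bilinear form on $V$. 2. If $\operatorname{char}F$ is odd and $n$ is even, there are, up to isomorphism, exactly two groups $\mathrm{O}(V,f)$ with $\dim V=n$ and $f$ nonsingular symmetric bilinear: both types of forms occur, and two such groups are isomorphic if and only if their forms are of the same type. They are $\mathrm{O}^+(n)$ (plus type) and $\mathrm{O}^-(n)$ (minus type). 3. If $\operatorname{char}F=2$ and $n$ is odd, nonsingular quadratic forms on $n$-dimensional spaces and symplectic forms on $(n-1)$-dimensional spaces exist, and $\mathrm{O}(V,Q)\cong\mathrm{Sp}(W,f)$ for every nonsingular quadratic form $Q$ on a space $V$ of dimension $n$ and every symplectic form $f$ on a space $W$ of dimension $n-1$. So, up to isomorphism, $\mathrm{Sp}(n-1)$ is the only orthogonal group of dimension $n$. 4. If $\operatorname{char}F=2$ and $n$ is even, there are, up to isomorphism, exactly two groups $\mathrm{O}(V,Q)$ with $\dim V=n$ and $Q$ a nonsingular quadratic form on $V$: both types of forms occur, and two such groups are isomorphic if and only if their forms are of the same type. They are $\mathrm{O}^+(n)$ (plus type) and $\mathrm{O}^-(n)$ (minus type). -/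

import Mathlib

/-- The group of invertible linear maps `g : V → V` with `f (g u) (g v) = f u v` for all `u v`.
For `f` symmetric and nonsingular this is the orthogonal group `O(V, f)`;
for `f` alternating and nonsingular it is the symplectic group `Sp(V, f)`.
(For nonsingular `f` on a finite-dimensional space a linear map that preserves `f` is
automatically invertible.) -/
def bilinIsometryGroup {F V : Type*} [Field F] [AddCommGroup V] [Module F V]
    (f : LinearMap.BilinForm F V) : Subgroup (V ≃ₗ[F] V) where
  carrier := {g | ∀ u v : V, f (g u) (g v) = f u v}
  one_mem' := fun _ _ => rfl
  mul_mem' := by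
    intro g h hg hh u v
    rw [LinearEquiv.mul_apply, LinearEquiv.mul_apply, hg, hh]
  inv_mem' := by
    intro g hg u v
    have h := hg (g⁻¹ u) (g⁻¹ v)
    have e : ∀ x : V, g (g⁻¹ x) = x := fun x => LinearEquiv.apply_symm_apply g x
    rw [e, e] at h
    exact h.symm

/-- The orthogonal group `O(V, Q)`: the group of invertible linear maps `g : V → V` with
`Q (g v) = Q v` for all `v`. (For nonsingular `Q` on a finite-dimensional space a linear map that
preserves `Q` is automatically invertible.) -/
def quadIsometryGroup {F V : Type*} [Field F] [AddCommGroup V] [Module F V]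
    (Q : QuadraticForm F V) : Subgroup (V ≃ₗ[F] V) where
  carrier := {g | ∀ v : V, Q (g v) = Q v}
  one_mem' := fun _ => rfl
  mul_mem' := by
    intro g h hg hh v
    rw [LinearEquiv.mul_apply, hg, hh]
  inv_mem' := by
    intro g hg v
    have h := hg (g⁻¹ v)
    have e : ∀ x : V, g (g⁻¹ x) = x := fun x => LinearEquiv.apply_symm_apply g x
    rw [e] at h
    exact h.symm

/-- A nonsingular symmetric bilinear form. -/
def IsOrthogonalForm {F V : Type*} [Field F] [AddCommGroup V] [Module F V]
    (f : LinearMap.BilinForm F V) : Prop :=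
  f.IsSymm ∧ f.Nondegenerate

/-- A symplectic form: a nonsingular alternating bilinear form. -/
def IsSymplecticForm {F V : Type*} [Field F] [AddCommGroup V] [Module F V]
    (f : LinearMap.BilinForm F V) : Prop :=
  f.IsAlt ∧ f.Nondegenerate

/-- A nonsingular quadratic form: the only `v` with `Q v = 0` that is orthogonal to all of `V`
for the polar form `f_Q (u, v) = Q (u + v) - Q u - Q v` is `v = 0`. (The polar form itself may be
singular in characteristic two.) -/
def IsNonsingularQuad {F V : Type*} [Field F] [AddCommGroup V] [Module F V]
    (Q : QuadraticForm F V) : Prop :=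
  Q.radical = ⊥

/-- The bilinear form `f` is of plus type: there is a totally isotropic subspace `W`
of dimension `dim V / 2`. For `dim V` even, `O(V, f)` is `O⁺` if `f` is of plus type,
and `O⁻` otherwise. -/
def IsPlusBilin {F V : Type*} [Field F] [AddCommGroup V] [Module F V]
    (f : LinearMap.BilinForm F V) : Prop :=
  ∃ W : Submodule F V, 2 * Module.finrank F W = Module.finrank F V ∧
    ∀ u ∈ W, ∀ w ∈ W, f u w = 0

/-- The quadratic form `Q` is of plus type: there is a subspace `W` of dimension `dim V / 2` on
which `Q` vanishes. For `dim V` even, `O(V, Q)` is `O⁺` if `Q` is of plus type,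
and `O⁻` otherwise. -/
def IsPlusQuad {F V : Type*} [Field F] [AddCommGroup V] [Module F V]
    (Q : QuadraticForm F V) : Prop :=
  ∃ W : Submodule F V, 2 * Module.finrank F W = Module.finrank F V ∧ ∀ w ∈ W, Q w = 0

/-! ### Nonsingularity, isometries, similitudes, and the number of zeros -/

section Basics

open Module QuadraticMap

variable {F V V' : Type*} [Field F] [AddCommGroup V] [Module F V] [AddCommGroup V'] [Module F V']

/-! Everything is reduced to quadratic forms. When 2 is invertible, a symmetric `f` and the form `v
↦ f v v` have the same group and the same type. In a nonsingular space each nonzero singular vector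
lies in a hyperbolic pair, which splits off a hyperbolic plane; by Chevalley–Warning such a vector
exists in dimension at least 3. Splitting therefore ends in dimension 0, on a line, or on an
anisotropic plane.

Odd dimension: the remaining lines carry `a x²`, any two of which are similar, and a similitude
extends over hyperbolic planes. Similar forms have conjugate groups
(`exists_similitude_of_odd_finrank`, `quadIsometryGroupCongr`). In characteristic 2 a symplectic
form on `W` is the polar form of some `q`, and its group is that of `q` plus the square form on a
line (`nonempty_mulEquiv_prod_sq`), a form similar to any given nonsingular `Q` of the same
dimension.

Even dimension: anisotropic planes are all isometric, so there are at most two classes. The number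
of zeros tells them apart and replaces Witt cancellation (`exists_isometryEquiv_of_zeroCount_eq`);
it defines a sign `ε`, with `ε = 1` exactly for plus type. The groups differ in order: with `q =
|F|`, orbit-stabilizer on hyperbolic pairs shows that `|O| (q^m + ε)` does not depend on `ε`
(`card_quadIsometryGroup_mul`). -/

theorem isNonsingularQuad_iff {Q : QuadraticForm F V} :
    IsNonsingularQuad Q ↔ ∀ v, Q v = 0 → (∀ w, polar Q v w = 0) → v = 0 := by
  rw [IsNonsingularQuad, Submodule.eq_bot_iff]
  refine forall_congr' fun v => ?_
  rw [mem_radical_iff', and_imp]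
  refine forall_congr' fun hv => ?_
  simp only [polar, hv, sub_zero, sub_eq_zero]

theorem polar_isometryEquiv {Q : QuadraticForm F V} {Q' : QuadraticForm F V'}
    (e : Q.IsometryEquiv Q') (v w : V) : polar Q' (e v) (e w) = polar Q v w := by
  simp only [polar, ← map_add, e.map_app]

theorem IsNonsingularQuad.of_isometryEquiv {Q : QuadraticForm F V} {Q' : QuadraticForm F V'}
    (h : IsNonsingularQuad Q) (e : Q.IsometryEquiv Q') : IsNonsingularQuad Q' := by
  rw [IsNonsingularQuad, ← e.map_radical, h, Submodule.map_bot]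

theorem finrank_eq_of_isometryEquiv {Q : QuadraticForm F V} {Q' : QuadraticForm F V'}
    (e : Q.IsometryEquiv Q') : finrank F V = finrank F V' :=
  e.toLinearEquiv.finrank_eq

theorem IsPlusQuad.of_isometryEquiv {Q : QuadraticForm F V} {Q' : QuadraticForm F V'}
    (h : IsPlusQuad Q) (e : Q.IsometryEquiv Q') : IsPlusQuad Q' := by
  obtain ⟨W, hW, hQ⟩ := h
  refine ⟨W.map e.toLinearEquiv.toLinearMap, ?_, ?_⟩
  · rw [LinearEquiv.finrank_map_eq, hW, finrank_eq_of_isometryEquiv e]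
  · rintro _ ⟨w, hw, rfl⟩
    exact (e.map_app w).trans (hQ w hw)

/-- A linear equivalence which multiplies the quadratic form by a nonzero scalar conjugates one
isometry group into the other. -/
def quadIsometryGroupCongr {Q : QuadraticForm F V} {Q' : QuadraticForm F V'} (e : V ≃ₗ[F] V')
    {c : F} (hc : c ≠ 0) (he : ∀ v, Q' (e v) = c * Q v) :
    quadIsometryGroup Q ≃* quadIsometryGroup Q' where
  toFun g := ⟨(e.symm.trans g.1).trans e, fun v => by
    have h := g.2 (e.symm v)
    simp [he, h, ← he (e.symm v)]⟩
  invFun g := ⟨(e.trans g.1).trans e.symm, fun v => by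
    have h := g.2 (e v)
    apply mul_left_cancel₀ hc
    simp [← he, h]⟩
  left_inv g := by ext v; simp
  right_inv g := by ext v; simp
  map_mul' g h := by ext v; simp

theorem card_quadIsometryGroup_eq {Q : QuadraticForm F V} {Q' : QuadraticForm F V'}
    (e : Q.IsometryEquiv Q') :
    Nat.card (quadIsometryGroup Q) = Nat.card (quadIsometryGroup Q') :=
  Nat.card_congr (quadIsometryGroupCongr e.toLinearEquiv one_ne_zero
    fun v => by rw [one_mul]; exact e.map_app v).toEquiv

/-- The number of singular vectors of a quadratic form, zero included. -/
noncomputable def zeroCount (Q : QuadraticForm F V) : ℕ :=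
  Nat.card {v : V // Q v = 0}

theorem zeroCount_eq {Q : QuadraticForm F V} {Q' : QuadraticForm F V'}
    (e : Q.IsometryEquiv Q') : zeroCount Q = zeroCount Q' :=
  Nat.card_congr (e.toLinearEquiv.toEquiv.subtypeEquiv fun v => by
    rw [← e.map_app v]; rfl)

end Basics

/-! ### Splitting off hyperbolic planes -/

section Hyperbolic

open Module QuadraticMap

variable {F V V' : Type*} [Field F] [AddCommGroup V] [Module F V] [AddCommGroup V'] [Module F V']

/-- The orthogonal sum of a hyperbolic plane and a quadratic form. -/
def hyperbolicSum (Q : QuadraticForm F V) : QuadraticForm F (F × F × V) :=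
  linMulLin (LinearMap.fst F F (F × V)) ((LinearMap.fst F F V).comp (LinearMap.snd F F (F × V))) +
    Q.comp ((LinearMap.snd F F V).comp (LinearMap.snd F F (F × V)))

@[simp]
theorem hyperbolicSum_apply (Q : QuadraticForm F V) (p : F × F × V) :
    hyperbolicSum Q p = p.1 * p.2.1 + Q p.2.2 := rfl

@[simp]
theorem polar_hyperbolicSum (Q : QuadraticForm F V) (p r : F × F × V) :
    polar (hyperbolicSum Q) p r = p.1 * r.2.1 + r.1 * p.2.1 + polar Q p.2.2 r.2.2 := by
  simp only [polar, hyperbolicSum_apply, Prod.fst_add, Prod.snd_add]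
  ring

/-- An isometry extends to the sums with a hyperbolic plane. -/
def hyperbolicSumCongr {Q : QuadraticForm F V} {Q' : QuadraticForm F V'}
    (e : Q.IsometryEquiv Q') : (hyperbolicSum Q).IsometryEquiv (hyperbolicSum Q') where
  toLinearEquiv := (LinearEquiv.refl F F).prodCongr ((LinearEquiv.refl F F).prodCongr
    e.toLinearEquiv)
  map_app' p := by
    have := e.map_app p.2.2
    simp [this]

@[simp]
theorem hyperbolicSumCongr_apply {Q : QuadraticForm F V} {Q' : QuadraticForm F V'}
    (e : Q.IsometryEquiv Q') (p : F × F × V) :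
    hyperbolicSumCongr e p = (p.1, p.2.1, e p.2.2) := rfl

theorem isNonsingularQuad_hyperbolicSum {Q : QuadraticForm F V} :
    IsNonsingularQuad (hyperbolicSum Q) ↔ IsNonsingularQuad Q := by
  simp only [isNonsingularQuad_iff]
  constructor
  · intro h v hv hp
    have := h (0, 0, v) (by simp [hv]) (by simp [hp])
    simpa using this
  · rintro h ⟨x, y, v⟩ hv hp
    have hx : x = 0 := by simpa using hp (0, 1, 0)
    have hy : y = 0 := by simpa using hp (1, 0, 0)
    subst hx hy
    have : v = 0 := h v (by simpa using hv) fun w => by simpa using hp (0, 0, w)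
    simp [this]

/-- The orthogonal complement of the span of two vectors. -/
def pairComplement (Q : QuadraticForm F V) (u w : V) : Submodule F V :=
  LinearMap.ker (Q.polarBilin u) ⊓ LinearMap.ker (Q.polarBilin w)

theorem mem_pairComplement {Q : QuadraticForm F V} {u w v : V} :
    v ∈ pairComplement Q u w ↔ polar Q u v = 0 ∧ polar Q w v = 0 := by
  simp [pairComplement]

/-- A single expansion serves most later computations; unused slots are filled with 0, whence the
artificial `+ 0` terms there. -/
theorem map_smul_add_smul_add (Q : QuadraticForm F V) (x y : F) (u w v : V) :
    Q (x • u + y • w + v) = x ^ 2 * Q u + y ^ 2 * Q w + x * y * polar Q u w + Q v +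
      x * polar Q u v + y * polar Q w v := by
  rw [QuadraticMap.map_add Q, QuadraticMap.map_add Q, QuadraticMap.map_smul, QuadraticMap.map_smul,
    polar_add_left, polar_smul_left, polar_smul_left, polar_smul_left, polar_smul_right]
  simp only [smul_eq_mul]
  ring

theorem polar_self_eq (Q : QuadraticForm F V) (v : V) : polar Q v v = 2 * Q v := by
  simp [polar_self]

/-- A hyperbolic pair splits off a hyperbolic plane. -/
def hyperbolicSplit (Q : QuadraticForm F V) {u w : V} (hu : Q u = 0) (hw : Q w = 0)
    (huw : polar Q u w = 1) :
    (hyperbolicSum (Q.comp (pairComplement Q u w).subtype)).IsometryEquiv Q where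
  toFun p := p.1 • u + p.2.1 • w + (p.2.2 : V)
  invFun v := (polar Q w v, polar Q u v, ⟨v - polar Q w v • u - polar Q u v • w, by
    rw [mem_pairComplement]
    simp [polar_sub_right, polar_smul_right, hu, hw, huw,
      polar_comm Q w u]⟩)
  left_inv := by
    rintro ⟨x, y, k, hk⟩
    rw [mem_pairComplement] at hk
    simp [polar_add_right, polar_smul_right, hu, hw, huw,
      polar_comm Q w u, hk]
    abel
  right_inv v := by simp
  map_add' p r := by
    simp only [Prod.fst_add, Prod.snd_add, add_smul, Submodule.coe_add]
    abel
  map_smul' c p := by simp [mul_smul]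
  map_app' p := by
    have hk := mem_pairComplement.1 p.2.2.2
    change Q (p.1 • u + p.2.1 • w + (p.2.2 : V)) = _
    rw [map_smul_add_smul_add, hu, hw, huw, hk.1, hk.2]
    simp

@[simp]
theorem hyperbolicSplit_apply (Q : QuadraticForm F V) {u w : V} (hu : Q u = 0) (hw : Q w = 0)
    (huw : polar Q u w = 1) (p : F × F × pairComplement Q u w) :
    hyperbolicSplit Q hu hw huw p = p.1 • u + p.2.1 • w + (p.2.2 : V) := rfl

/-- In a nonsingular space every nonzero singular vector is part of a hyperbolic pair. -/
theorem IsNonsingularQuad.exists_hyperbolic_pair {Q : QuadraticForm F V}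
    (h : IsNonsingularQuad Q) {u : V} (hu : Q u = 0) (hu0 : u ≠ 0) :
    ∃ w, Q w = 0 ∧ polar Q u w = 1 := by
  by_contra! H
  refine hu0 (isNonsingularQuad_iff.1 h u hu fun w => ?_)
  by_contra hw
  set w₁ := (polar Q u w)⁻¹ • w with hw₁
  have h1 : polar Q u w₁ = 1 := by
    rw [hw₁, polar_smul_right, smul_eq_mul, inv_mul_cancel₀ hw]
  -- As `polar Q u w₁ = 1`, subtracting `Q w₁ • u` makes the vector singular; as `polar Q u u = 2 *
  -- Q u = 0`, its product with `u` stays 1.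
  refine H (w₁ - Q w₁ • u) ?_ ?_
  · have := map_smul_add_smul_add Q (-Q w₁) 1 u w₁ 0
    have e : w₁ - Q w₁ • u = (-Q w₁) • u + (1 : F) • w₁ + 0 := by module
    rw [e, this, hu, h1]
    simp
  · simp [polar_sub_right, polar_smul_right, hu, h1]

theorem finrank_hyperbolicSum [FiniteDimensional F V] :
    finrank F (F × F × V) = finrank F V + 2 := by
  simp only [finrank_prod, finrank_self]
  ring

/-- A nonsingular space with a nonzero singular vector is the sum of a hyperbolic plane and a
nonsingular subspace. -/
theorem IsNonsingularQuad.exists_split [FiniteDimensional F V] {Q : QuadraticForm F V}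
    (h : IsNonsingularQuad Q) {u : V} (hu : Q u = 0) (hu0 : u ≠ 0) :
    ∃ (K : Submodule F V), IsNonsingularQuad (Q.comp K.subtype) ∧
      finrank F V = finrank F K + 2 ∧
      Nonempty ((hyperbolicSum (Q.comp K.subtype)).IsometryEquiv Q) := by
  obtain ⟨w, hw, huw⟩ := h.exists_hyperbolic_pair hu hu0
  let e := hyperbolicSplit Q hu hw huw
  refine ⟨pairComplement Q u w, ?_, ?_, ⟨e⟩⟩
  · exact isNonsingularQuad_hyperbolicSum.1 (h.of_isometryEquiv e.symm)
  · rw [← finrank_eq_of_isometryEquiv e, finrank_hyperbolicSum]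

end Hyperbolic

/-! ### Counting zeros; existence of singular vectors -/

section Counting

open Module QuadraticMap

variable {F V V' : Type*} [Field F] [AddCommGroup V] [Module F V] [AddCommGroup V'] [Module F V']

open Classical in
/-- The singular vectors of a sum with a hyperbolic plane, sorted by their second coordinate. -/
noncomputable def zerosHyperbolicSumEquiv (Q : QuadraticForm F V) :
    {p : F × F × V // hyperbolicSum Q p = 0} ≃ (Fˣ × V) ⊕ (F × {v : V // Q v = 0}) where
  toFun p := if h : p.1.2.1 = 0 then Sum.inr (p.1.1, ⟨p.1.2.2, by simpa [h] using p.2⟩)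
    else Sum.inl (Units.mk0 _ h, p.1.2.2)
  invFun s := s.elim (fun a => ⟨(-Q a.2 / a.1, a.1, a.2), by simp⟩)
    (fun a => ⟨(a.1, 0, a.2.1), by simp [a.2.2]⟩)
  left_inv := by
    rintro ⟨⟨x, y, v⟩, h⟩
    by_cases hy : y = 0
    · simp [hy]
    · simp only [hyperbolicSum_apply] at h
      have hx : -Q v / y = x := by
        rw [div_eq_iff hy]
        linear_combination -h
      simp [hy, hx]
  right_inv := by
    rintro (⟨y, v⟩ | ⟨x, v, hv⟩)
    · simp
    · simp

/-- In `x y + Q v = 0`, a nonzero `y` determines `x`, while `y = 0` leaves `x` free. The additive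
form avoids subtraction in `ℕ`, and cancelling `Nat.card F` recovers the zero count of `Q` from that
of the sum. -/
theorem zeroCount_hyperbolicSum [Finite F] [FiniteDimensional F V] (Q : QuadraticForm F V) :
    zeroCount (hyperbolicSum Q) + Nat.card V = Nat.card F * (zeroCount Q + Nat.card V) := by
  have := Module.finite_of_finite F (M := V)
  rw [zeroCount, Nat.card_congr (zerosHyperbolicSumEquiv Q), Nat.card_sum, Nat.card_prod,
    Nat.card_prod, Nat.card_units, zeroCount]
  obtain ⟨q, hq⟩ : ∃ q, Nat.card F = q + 1 := ⟨_, (Nat.succ_pred_eq_of_pos Nat.card_pos).symm⟩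
  rw [hq, Nat.add_sub_cancel]
  ring

theorem exists_singular_of_zeroCount_ne_one [Finite V] {Q : QuadraticForm F V}
    (h : zeroCount Q ≠ 1) : ∃ u, Q u = 0 ∧ u ≠ 0 := by
  by_contra! H
  apply h
  rw [zeroCount, Nat.card_eq_one_iff_unique]
  refine ⟨⟨fun a b => Subtype.ext ?_⟩, ⟨⟨0, by simp⟩⟩⟩
  rw [H _ a.2, H _ b.2]

theorem zeroCount_eq_one_of_anisotropic {Q : QuadraticForm F V} (h : Q.Anisotropic) :
    zeroCount Q = 1 := by
  rw [zeroCount, Nat.card_eq_one_iff_unique]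
  refine ⟨⟨fun a b => Subtype.ext ?_⟩, ⟨⟨0, by simp⟩⟩⟩
  rw [h _ a.2, h _ b.2]

theorem anisotropic_of_zeroCount_eq_one {Q : QuadraticForm F V} (h : zeroCount Q = 1) :
    Q.Anisotropic := by
  rw [zeroCount, Nat.card_eq_one_iff_unique] at h
  intro v hv
  have := h.1.elim ⟨v, hv⟩ ⟨0, by simp⟩
  simpa using this

/-- A quadratic form in at least three variables over a finite field has a nontrivial zero. -/
theorem exists_singular_of_three_le_finrank [Finite F] (Q : QuadraticForm F V)
    (h : 3 ≤ finrank F V) : ∃ u, Q u = 0 ∧ u ≠ 0 := by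
  classical
  have : FiniteDimensional F V := Module.finite_of_finrank_pos (by omega)
  have := Fintype.ofFinite F
  obtain ⟨B, rfl⟩ := LinearMap.BilinMap.toQuadraticMap_surjective Q
  let b := finBasis F V
  let f : MvPolynomial (Fin (finrank F V)) F :=
    ∑ i, ∑ j, MvPolynomial.C (B (b i) (b j)) * MvPolynomial.X i * MvPolynomial.X j
  have hdeg : f.totalDegree < Fintype.card (Fin (finrank F V)) := by
    rw [Fintype.card_fin]
    refine lt_of_le_of_lt ?_ h
    refine MvPolynomial.totalDegree_finsetSum_le fun i _ =>
      MvPolynomial.totalDegree_finsetSum_le fun j _ => ?_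
    refine (MvPolynomial.totalDegree_mul _ _).trans ?_
    refine (Nat.add_le_add_right (MvPolynomial.totalDegree_mul _ _) _).trans ?_
    simp
  have heval : ∀ x, MvPolynomial.eval x f = B (∑ i, x i • b i) (∑ i, x i • b i) := by
    intro x
    simp only [f, map_sum, map_mul, MvPolynomial.eval_C, MvPolynomial.eval_X, map_smul,
      LinearMap.sum_apply, LinearMap.smul_apply, smul_eq_mul, Finset.mul_sum]
    rw [Finset.sum_comm]
    refine Finset.sum_congr rfl fun i _ => Finset.sum_congr rfl fun j _ => ?_
    ring
  -- Chevalley–Warning: the degree is at most 2, below the number of variables, so the zero vector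
  -- cannot be the only solution.
  have hdvd := char_dvd_card_solutions (ringChar F) hdeg
  have hp : (ringChar F).Prime := CharP.char_is_prime F _
  let z : {x // MvPolynomial.eval x f = 0} := ⟨0, by rw [heval]; simp⟩
  have hpos : 0 < Fintype.card {x // MvPolynomial.eval x f = 0} := Fintype.card_pos_iff.2 ⟨z⟩
  obtain ⟨y, hy⟩ := Fintype.exists_ne_of_one_lt_card
    (hp.one_lt.trans_le (Nat.le_of_dvd hpos hdvd)) z
  refine ⟨∑ i, y.1 i • b i, ?_, fun h0 => hy (Subtype.ext (funext fun i => ?_))⟩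
  · simpa [heval] using y.2
  · exact linearIndependent_iff'.1 b.linearIndependent Finset.univ _ h0 i (Finset.mem_univ _)

end Counting

/-! ### Similarity in odd dimension -/

section OddDimension

open Module QuadraticMap

variable {F : Type*} [Field F]

theorem exists_coordinate_of_finrank_eq_one {V : Type*} [AddCommGroup V] [Module F V]
    {Q : QuadraticForm F V} (hV : finrank F V = 1) (hQ : IsNonsingularQuad Q) :
    ∃ (e : V ≃ₗ[F] F) (a : F), a ≠ 0 ∧ ∀ v, Q v = a * e v ^ 2 := by
  have : FiniteDimensional F V := Module.finite_of_finrank_pos (by omega)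
  let e := LinearEquiv.ofFinrankEq V F (by rw [hV, finrank_self])
  have h : ∀ v, Q v = Q (e.symm 1) * e v ^ 2 := by
    intro v
    have hv : v = e v • e.symm 1 := by rw [← map_smul]; simp
    conv_lhs => rw [hv, QuadraticMap.map_smul, smul_eq_mul]
    ring
  refine ⟨e, Q (e.symm 1), fun h0 => ?_, h⟩
  have hzero : ∀ v, Q v = 0 := fun v => by rw [h, h0, zero_mul]
  have := isNonsingularQuad_iff.1 hQ (e.symm 1) h0 fun w => by simp [polar, hzero]
  simp at this

/-- Nonsingular forms of equal odd dimension over a finite field are similar. -/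
theorem exists_similitude_of_odd_finrank [Finite F] (k : ℕ) : ∀ {V V' : Type*}
    [AddCommGroup V] [Module F V] [AddCommGroup V'] [Module F V'] (Q : QuadraticForm F V) (Q' : QuadraticForm F V'),
    finrank F V = 2 * k + 1 → finrank F V' = 2 * k + 1 →
    IsNonsingularQuad Q → IsNonsingularQuad Q' →
    ∃ (e : V ≃ₗ[F] V') (c : F), c ≠ 0 ∧ ∀ v, Q' (e v) = c * Q v := by
  induction k with
  | zero =>
    intro V V' _ _ _ _ Q Q' hV hV' hQ hQ'
    obtain ⟨e, a, ha, he⟩ := exists_coordinate_of_finrank_eq_one hV hQ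
    obtain ⟨e', a', ha', he'⟩ := exists_coordinate_of_finrank_eq_one hV' hQ'
    refine ⟨e.trans e'.symm, a' / a, div_ne_zero ha' ha, fun v => ?_⟩
    rw [he, he', LinearEquiv.trans_apply, LinearEquiv.apply_symm_apply]
    field_simp
  | succ k ih =>
    intro V V' _ _ _ _ Q Q' hV hV' hQ hQ'
    have : FiniteDimensional F V := Module.finite_of_finrank_pos (by omega)
    have : FiniteDimensional F V' := Module.finite_of_finrank_pos (by omega)
    obtain ⟨u, hu, hu0⟩ := exists_singular_of_three_le_finrank Q (by omega)
    obtain ⟨u', hu', hu0'⟩ := exists_singular_of_three_le_finrank Q' (by omega)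
    obtain ⟨K, hK, hd, ⟨e⟩⟩ := hQ.exists_split hu hu0
    obtain ⟨K', hK', hd', ⟨e'⟩⟩ := hQ'.exists_split hu' hu0'
    obtain ⟨g, c, hc, hg⟩ := ih _ _ (by omega) (by omega) hK hK'
    -- Scaling only the first coordinate of the hyperbolic plane by `c` multiplies `x y` by `c`.
    refine ⟨(e.symm.toLinearEquiv.trans ((LinearEquiv.smulOfUnit (Units.mk0 c hc)).prodCongr
      ((LinearEquiv.refl F F).prodCongr g))).trans e'.toLinearEquiv, c, hc, fun v => ?_⟩
    have h1 := e'.map_app ((LinearEquiv.smulOfUnit (Units.mk0 c hc)).prodCongr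
      ((LinearEquiv.refl F F).prodCongr g) (e.symm v))
    refine h1.trans ?_
    rw [← e.symm.map_app v, hyperbolicSum_apply, hyperbolicSum_apply, mul_add, ← hg]
    exact congrArg (· + _) (mul_assoc c _ _)

end OddDimension

/-! ### Anisotropic planes: normal forms, uniqueness, representation numbers -/

section Plane

open Module QuadraticMap

variable {F V V' : Type*} [Field F] [AddCommGroup V] [Module F V] [AddCommGroup V'] [Module F V']

/-- Coordinates on a plane with respect to two independent vectors. -/
theorem exists_plane_coordinates (hV : finrank F V = 2) {u w : V} (hu : u ≠ 0)
    (hw : ∀ c : F, w ≠ c • u) :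
    ∃ e : (F × F) ≃ₗ[F] V, ∀ p, e p = p.1 • u + p.2 • w := by
  have : FiniteDimensional F V := Module.finite_of_finrank_pos (by omega)
  let l : (F × F) →ₗ[F] V := (LinearMap.toSpanSingleton F V u).coprod
    (LinearMap.toSpanSingleton F V w)
  have hl : ∀ p, l p = p.1 • u + p.2 • w := fun p => rfl
  have hinj : Function.Injective l := by
    rw [injective_iff_map_eq_zero]
    rintro ⟨x, y⟩ h
    rw [hl] at h
    have hy : y = 0 := by
      by_contra hy
      refine hw (-x / y) ?_
      have : y • w = (-x) • u := by
        rw [neg_smul, eq_neg_iff_add_eq_zero, add_comm]; exact h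
      rw [div_eq_inv_mul, mul_smul, ← this, inv_smul_smul₀ hy]
    subst hy
    simpa [hu] using h
  exact ⟨LinearEquiv.ofInjectiveOfFinrankEq l hinj (by simp [hV]), hl⟩

theorem exists_not_smul (hV : finrank F V = 2) (u : V) : ∃ w : V, ∀ c : F, w ≠ c • u := by
  by_contra! H
  have : finrank F V ≤ 1 := finrank_le_one u fun w => (H w).imp fun c hc => hc.symm
  omega

theorem exists_polar_eq_zero (hV : finrank F V = 2) (Q : QuadraticForm F V) (u : V) :
    ∃ w, w ≠ 0 ∧ polar Q u w = 0 := by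
  have : FiniteDimensional F V := Module.finite_of_finrank_pos (by omega)
  have h : LinearMap.ker (Q.polarBilin u) ≠ ⊥ := fun h => by
    have := LinearMap.finrank_range_add_finrank_ker (Q.polarBilin u)
    have h1 := Submodule.finrank_le (LinearMap.range (Q.polarBilin u))
    rw [h, finrank_bot, hV] at this
    rw [finrank_self] at h1
    omega
  obtain ⟨w, hw, hw0⟩ := Submodule.exists_mem_ne_zero_of_ne_bot h
  exact ⟨w, hw0, by simpa using hw⟩

theorem ringChar_eq_two_of_two_eq_zero (h : (2 : F) = 0) : ringChar F = 2 := by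
  have h2 : ringChar F ∣ 2 := ringChar.dvd (by exact_mod_cast h)
  have h1 : ringChar F ≠ 1 := CharP.ringChar_ne_one
  exact ((Nat.dvd_prime Nat.prime_two).1 h2).resolve_left h1

theorem two_eq_zero_of_ringChar_eq_two (h : ringChar F = 2) : (2 : F) = 0 := by
  have := ringChar.Nat.cast_ringChar (R := F)
  rw [h] at this
  exact_mod_cast this

/-- If `u` were orthogonal to everything, `polar Q u u = 2 * Q u` would force characteristic 2.
There every scalar is a square, so some `w - t • u` with `w` outside the line of `u` would be
singular. -/
theorem exists_polar_eq_one [Finite F] (hV : finrank F V = 2) {Q : QuadraticForm F V}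
    (hQ : Q.Anisotropic) {u : V} (hu : u ≠ 0) : ∃ w, polar Q u w = 1 := by
  suffices h : ∃ w, polar Q u w ≠ 0 by
    obtain ⟨w, hw⟩ := h
    exact ⟨(polar Q u w)⁻¹ • w, by rw [polar_smul_right, smul_eq_mul, inv_mul_cancel₀ hw]⟩
  by_contra! H
  have hQu : Q u ≠ 0 := fun h => hu (hQ u h)
  have h2 : (2 : F) = 0 := by simpa [polar_self_eq, hQu] using H u
  obtain ⟨w, hw⟩ := exists_not_smul hV u
  obtain ⟨t, ht⟩ := FiniteField.isSquare_of_char_two (ringChar_eq_two_of_two_eq_zero h2)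
    (Q w / Q u)
  have h0 : Q ((-t) • u + (1 : F) • w + 0) = 0 := by
    rw [map_smul_add_smul_add, H, neg_sq, pow_two, ← ht]
    simp only [div_mul_cancel₀ _ hQu, polar_zero_right, QuadraticMap.map_zero]
    linear_combination Q w * h2
  refine hw t ?_
  have := hQ _ h0
  rw [add_zero, one_smul, neg_smul] at this
  exact (neg_add_eq_zero.1 this).symm

theorem isNonsingularQuad_of_anisotropic {Q : QuadraticForm F V} (hQ : Q.Anisotropic) :
    IsNonsingularQuad Q :=
  isNonsingularQuad_iff.2 fun v hv _ => hQ v hv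

open Polynomial in
theorem exists_mul_sq_add_mul_sq_eq_one [Finite F] (hF : ringChar F ≠ 2) {a b : F} (ha : a ≠ 0)
    (hb : b ≠ 0) : ∃ x y, a * x ^ 2 + b * y ^ 2 = 1 := by
  have := Fintype.ofFinite F
  obtain ⟨x, y, h⟩ := FiniteField.exists_root_sum_quadratic (R := F)
    (f := C a * X ^ 2 + C 0 * X + C (-1)) (g := C b * X ^ 2 + C 0 * X + C 0)
    (degree_quadratic ha) (degree_quadratic hb) (FiniteField.odd_card_of_char_ne_two hF)
  refine ⟨x, y, ?_⟩
  simp at h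
  linear_combination h

theorem exists_sq_mul_eq_of_not_isSquare [Finite F] {d d' : F}
    (hd : ¬ IsSquare d) (hd' : ¬ IsSquare d') : ∃ s, d' = s ^ 2 * d := by
  classical
  have := Fintype.ofFinite F
  have hd0 : d ≠ 0 := fun h => hd (h ▸ IsSquare.zero)
  have hd0' : d' ≠ 0 := fun h => hd' (h ▸ IsSquare.zero)
  have h : IsSquare (d * d') := by
    rw [← quadraticChar_one_iff_isSquare (mul_ne_zero hd0 hd0'), map_mul,
      quadraticChar_neg_one_iff_not_isSquare.2 hd, quadraticChar_neg_one_iff_not_isSquare.2 hd']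
    rfl
  obtain ⟨r, hr⟩ := h
  refine ⟨r / d, ?_⟩
  field_simp
  linear_combination hr

/-- In characteristic 2 the map `x ↦ x² + x` is additive with kernel `{0, 1}`, so its image has
index 2 and the sum of two elements outside lies inside. -/
theorem exists_sq_add_self_eq [Finite F] (h2 : (2 : F) = 0) {c c' : F}
    (hc : ∀ d, d ^ 2 + d ≠ c) (hc' : ∀ d, d ^ 2 + d ≠ c') : ∃ d, d ^ 2 + d = c + c' := by
  let f : F →+ F :=
    { toFun := fun x => x ^ 2 + x
      map_zero' := by simp
      map_add' := fun x y => by linear_combination x * y * h2 }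
  have hker : (f.ker : Set F) = {0, 1} := by
    ext x
    have h1 : (-1 : F) = 1 := by linear_combination -h2
    have : x ^ 2 + x = x * (x + 1) := by ring
    simp only [SetLike.mem_coe, AddMonoidHom.mem_ker, AddMonoidHom.coe_mk, ZeroHom.coe_mk,
      Set.mem_insert_iff, Set.mem_singleton_iff, f, this, mul_eq_zero, add_eq_zero_iff_eq_neg, h1]
  have hcard : Nat.card f.ker = 2 := by
    have := congrArg Set.ncard hker
    rwa [Set.ncard_pair zero_ne_one, ← Nat.card_coe_set_eq] at this
  have e1 := f.ker.card_mul_index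
  have e2 := f.range.card_mul_index
  rw [hcard, AddSubgroup.index_ker, mul_comm, ← e2] at e1
  have hidx : f.range.index = 2 := (Nat.eq_of_mul_eq_mul_left Nat.card_pos e1).symm
  have := (AddSubgroup.add_mem_iff_of_index_two hidx (a := c) (b := c')).2
    ⟨fun ⟨d, hd⟩ => (hc d hd).elim, fun ⟨d, hd⟩ => (hc' d hd).elim⟩
  exact this

/-- A diagonal binary form over a finite field of odd characteristic represents 1; a vector of value
1 and one orthogonal to it form the basis. Were `d = r * r`, the point `(r, 1)` would be singular.
-/
theorem exists_sq_sub_form [Finite F] (hF : ringChar F ≠ 2) (hV : finrank F V = 2)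
    {Q : QuadraticForm F V} (hQ : Q.Anisotropic) :
    ∃ (e : (F × F) ≃ₗ[F] V) (d : F), ¬ IsSquare d ∧ ∀ p, Q (e p) = p.1 ^ 2 - d * p.2 ^ 2 := by
  have h2 : (2 : F) ≠ 0 := fun h => hF (ringChar_eq_two_of_two_eq_zero h)
  have hnz : ∀ v, v ≠ 0 → Q v ≠ 0 := fun v hv h => hv (hQ v h)
  have : Nontrivial V := Module.nontrivial_of_finrank_pos (R := F) (by omega)
  have key : ∀ u w : V, u ≠ 0 → w ≠ 0 → polar Q u w = 0 → ∀ c : F, w ≠ c • u := by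
    rintro u w hu hw h c rfl
    rw [polar_smul_right, polar_self_eq] at h
    have hc : c ≠ 0 := fun h => hw (by simp [h])
    simp [h2, hc, hnz u hu] at h
  obtain ⟨u₀, hu₀⟩ := exists_ne (0 : V)
  obtain ⟨w₀, hw₀, h₀⟩ := exists_polar_eq_zero hV Q u₀
  obtain ⟨x, y, hxy⟩ := exists_mul_sq_add_mul_sq_eq_one hF (hnz _ hu₀) (hnz _ hw₀)
  set u := x • u₀ + y • w₀ + 0 with hu
  have hQu : Q u = 1 := by
    rw [hu, map_smul_add_smul_add, h₀, ← hxy]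
    simp
    ring
  have hu0 : u ≠ 0 := fun h => by simp [h] at hQu
  obtain ⟨w, hw, huw⟩ := exists_polar_eq_zero hV Q u
  obtain ⟨e, he⟩ := exists_plane_coordinates hV hu0 (key u w hu0 hw huw)
  have hform : ∀ p, Q (e p) = p.1 ^ 2 - (-Q w) * p.2 ^ 2 := fun p => by
    rw [he, ← add_zero (p.1 • u + p.2 • w), map_smul_add_smul_add, huw, hQu]
    simp
    ring
  refine ⟨e, -Q w, ?_, hform⟩
  rintro ⟨r, hr⟩
  have h := hform (r, 1)
  rw [hr] at h
  have := hQ _ (h.trans (by ring))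
  simp at this

/-- All scalars are squares, so some `u` has value 1; the basis is completed by `w` with `polar Q u
w = 1`. Were `c = d² + d`, the point `(d, 1)` would be singular. -/
theorem exists_sq_add_mul_form [Finite F] (hF : ringChar F = 2) (hV : finrank F V = 2)
    {Q : QuadraticForm F V} (hQ : Q.Anisotropic) :
    ∃ (e : (F × F) ≃ₗ[F] V) (c : F), (∀ d, d ^ 2 + d ≠ c) ∧
      ∀ p, Q (e p) = p.1 ^ 2 + p.1 * p.2 + c * p.2 ^ 2 := by
  have h2 := two_eq_zero_of_ringChar_eq_two hF
  have hnz : ∀ v, v ≠ 0 → Q v ≠ 0 := fun v hv h => hv (hQ v h)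
  have : Nontrivial V := Module.nontrivial_of_finrank_pos (R := F) (by omega)
  obtain ⟨u₀, hu₀⟩ := exists_ne (0 : V)
  obtain ⟨s, hs⟩ := FiniteField.isSquare_of_char_two hF (Q u₀)⁻¹
  set u := s • u₀ with hu
  have hQu : Q u = 1 := by
    rw [hu, QuadraticMap.map_smul, ← hs, smul_eq_mul, inv_mul_cancel₀ (hnz _ hu₀)]
  have hu0 : u ≠ 0 := fun h => by simp [h] at hQu
  obtain ⟨w, huw⟩ := exists_polar_eq_one hV hQ hu0
  obtain ⟨e, he⟩ := exists_plane_coordinates hV hu0 (w := w) (by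
    rintro c rfl
    rw [polar_smul_right, polar_self_eq, h2] at huw
    simp at huw)
  have hform : ∀ p, Q (e p) = p.1 ^ 2 + p.1 * p.2 + Q w * p.2 ^ 2 := fun p => by
    rw [he, ← add_zero (p.1 • u + p.2 • w), map_smul_add_smul_add, huw, hQu]
    simp
    ring
  refine ⟨e, Q w, fun d hd => ?_, hform⟩
  have h := hform (d, 1)
  rw [← hd] at h
  have := hQ _ (h.trans (by linear_combination (d ^ 2 + d) * h2))
  simp at this

/-- Two anisotropic planes over a finite field are isometric. -/
theorem exists_isometryEquiv_of_anisotropic_plane [Finite F] (hV : finrank F V = 2)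
    (hV' : finrank F V' = 2) {Q : QuadraticForm F V} {Q' : QuadraticForm F V'}
    (hQ : Q.Anisotropic) (hQ' : Q'.Anisotropic) : Nonempty (Q.IsometryEquiv Q') := by
  by_cases hF : ringChar F = 2
  · have h2 := two_eq_zero_of_ringChar_eq_two hF
    obtain ⟨e, c, hc, he⟩ := exists_sq_add_mul_form hF hV hQ
    obtain ⟨e', c', hc', he'⟩ := exists_sq_add_mul_form hF hV' hQ'
    obtain ⟨d, hd⟩ := exists_sq_add_self_eq h2 hc hc'
    -- The shear `x ↦ x + d y` adds `d² + d = c + c'` to the coefficient `c'` of `y²`, giving `c`.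
    let g : (F × F) ≃ₗ[F] (F × F) :=
      { toFun := fun p => (p.1 + d * p.2, p.2)
        invFun := fun p => (p.1 - d * p.2, p.2)
        left_inv := fun p => by simp
        right_inv := fun p => by simp
        map_add' := fun p r => by ext <;> simp; ring
        map_smul' := fun a p => by ext <;> simp; ring }
    refine ⟨⟨(e.symm.trans g).trans e', fun v => ?_⟩⟩
    obtain ⟨p, rfl⟩ := e.surjective v
    change Q' (e' (g (e.symm (e p)))) = _
    rw [e.symm_apply_apply, he', he]
    simp only [LinearEquiv.coe_mk, LinearMap.coe_mk, AddHom.coe_mk, g]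
    linear_combination p.2 ^ 2 * hd + (c' * p.2 ^ 2 + p.1 * p.2 * d) * h2
  · obtain ⟨e, d, hd, he⟩ := exists_sq_sub_form hF hV hQ
    obtain ⟨e', d', hd', he'⟩ := exists_sq_sub_form hF hV' hQ'
    obtain ⟨s, hs⟩ := exists_sq_mul_eq_of_not_isSquare hd' hd
    have hs0 : s ≠ 0 := by
      rintro rfl
      exact hd ⟨0, by rw [hs]; ring⟩
    refine ⟨⟨(e.symm.trans ((LinearEquiv.refl F F).prodCongr
      (LinearEquiv.smulOfNeZero F F s hs0))).trans e', fun v => ?_⟩⟩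
    obtain ⟨p, rfl⟩ := e.surjective v
    change Q' (e' ((e.symm (e p)).1, s • (e.symm (e p)).2)) = _
    rw [e.symm_apply_apply, he', he, hs]
    simp only [smul_eq_mul]
    ring

/-- Vectors of an anisotropic space with coordinate `t` satisfying `Q v = a t ^ 2`, sorted by
whether `t` vanishes. -/
noncomputable def anisotropicZerosEquiv {Q : QuadraticForm F V} (hQ : Q.Anisotropic) (a : F) :
    {p : V × F // Q p.1 = a * p.2 ^ 2} ≃ Option (Fˣ × {v : V // Q v = a}) := by
  classical
  exact
  { toFun := fun p => if h : p.1.2 = 0 then none else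
      some (Units.mk0 _ h, ⟨(p.1.2)⁻¹ • p.1.1, by
        rw [QuadraticMap.map_smul, p.2, smul_eq_mul]; field_simp⟩)
    invFun := fun s => s.elim ⟨0, by simp⟩ fun r => ⟨((r.1 : F) • r.2.1, r.1), by
      rw [QuadraticMap.map_smul, r.2.2, smul_eq_mul]; ring⟩
    left_inv := by
      rintro ⟨⟨v, t⟩, h⟩
      by_cases ht : t = 0
      · subst ht
        have : v = 0 := hQ v (by simpa using h)
        simp only [this, ↓reduceDIte, Option.elim_none]
        rfl
      · simp [ht]
    right_inv := by
      rintro (_ | ⟨t, v, hv⟩)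
      · simp
      · simp }

/-- In an anisotropic plane every nonzero scalar is a value at exactly `q + 1` vectors. -/
theorem card_eq_of_anisotropic_plane [Finite F] (hV : finrank F V = 2) {Q : QuadraticForm F V}
    (hQ : Q.Anisotropic) {a : F} (ha : a ≠ 0) :
    Nat.card {v : V // Q v = a} = Nat.card F + 1 := by
  have : FiniteDimensional F V := Module.finite_of_finrank_pos (by omega)
  have : Finite V := Module.finite_of_finite F
  -- The zeros of `Q v - a t²` are counted twice. The form is a hyperbolic plane plus an anisotropic
  -- line, so it has `q²` zeros; sorting by `t` gives `1 + (q - 1) N`, where `N` is the number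
  -- sought. Hence `N = q + 1`.
  let R : QuadraticForm F (V × F) := Q.prod ((-a) • QuadraticMap.sq)
  have hR : ∀ p, R p = Q p.1 - a * p.2 ^ 2 := fun p => by
    simp [R, prod_apply]; ring
  have hRns : IsNonsingularQuad R := by
    rw [isNonsingularQuad_iff]
    rintro ⟨v, t⟩ h hp
    have hv : v = 0 := by
      by_contra hv
      obtain ⟨w, hw⟩ := exists_polar_eq_one hV hQ hv
      have := hp (w, 0)
      simp only [polar, hR, Prod.fst_add, Prod.snd_add] at this hw
      have : (1 : F) = 0 := by rw [← hw]; linear_combination this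
      exact one_ne_zero this
    subst hv
    rw [hR] at h
    simpa [ha] using h
  have hdim : finrank F (V × F) = 3 := by simp [hV]
  obtain ⟨u, hu, hu0⟩ := exists_singular_of_three_le_finrank R (by omega)
  obtain ⟨K, hK, hd, ⟨e⟩⟩ := hRns.exists_split hu hu0
  have hd1 : finrank F K = 1 := by omega
  obtain ⟨g, b, hb, hg⟩ := exists_coordinate_of_finrank_eq_one hd1 hK
  have hKa : (R.comp K.subtype).Anisotropic := fun v hv => by
    rw [hg] at hv
    simpa [hb] using hv
  have h1 := zeroCount_hyperbolicSum (R.comp K.subtype)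
  rw [zeroCount_eq e, zeroCount_eq_one_of_anisotropic hKa, Module.natCard_eq_pow_finrank (K := F),
    hd1] at h1
  have h2 : zeroCount R = Nat.card {p : V × F // Q p.1 = a * p.2 ^ 2} :=
    Nat.card_congr (Equiv.subtypeEquivRight fun p => by rw [hR, sub_eq_zero])
  rw [h2, Nat.card_congr (anisotropicZerosEquiv hQ a), Finite.card_option, Nat.card_prod,
    Nat.card_units] at h1
  have hq : 1 < Nat.card F := Finite.one_lt_card
  obtain ⟨r, hr⟩ : ∃ r, Nat.card F = r + 2 := ⟨Nat.card F - 2, by omega⟩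
  rw [hr] at h1 ⊢
  rw [show r + 2 - 1 = r + 1 by omega] at h1
  apply Nat.eq_of_mul_eq_mul_left (Nat.succ_pos r)
  rw [Nat.succ_eq_add_one]
  linarith

end Plane

/-! ### Reflections and the group of an anisotropic plane -/

section GroupOrder

open Module QuadraticMap

variable {F V V' : Type*} [Field F] [AddCommGroup V] [Module F V] [AddCommGroup V'] [Module F V']

theorem card_eq_ncard_orbit_mul_card_stabilizer {G X : Type*} [Group G] [MulAction G X] (x : X) :
    Nat.card G = (MulAction.orbit G x).ncard * Nat.card (MulAction.stabilizer G x) := by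
  rw [← MulAction.index_stabilizer, mul_comm, Subgroup.card_mul_index]

/-- The reflection in a nonsingular vector, as an element of the isometry group. -/
noncomputable def quadReflection (Q : QuadraticForm F V) {z : V} (hz : Q z ≠ 0) :
    quadIsometryGroup Q :=
  ⟨Module.reflection (x := z) (f := (Q z)⁻¹ • Q.polarBilin z) (by
    simp only [LinearMap.smul_apply, polarBilin_apply_apply, polar_self_eq, smul_eq_mul]
    field_simp), fun v => by
    have h := map_smul_add_smul_add Q (-((Q z)⁻¹ * polar Q z v)) 0 z 0 v
    rw [Module.reflection_apply, sub_eq_neg_add, ← neg_smul]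
    simp only [LinearMap.smul_apply, polarBilin_apply_apply, smul_eq_mul]
    simp only [smul_zero, add_zero, zero_mul, mul_zero] at h
    rw [h]
    field_simp
    simp⟩

theorem quadReflection_apply (Q : QuadraticForm F V) {z : V} (hz : Q z ≠ 0) (v : V) :
    (quadReflection Q hz : V ≃ₗ[F] V) v = v - ((Q z)⁻¹ * polar Q z v) • z := by
  rw [quadReflection, Module.reflection_apply]
  simp

/-- In an anisotropic space, vectors with the same value are conjugate. -/
theorem exists_isometry_apply_eq_of_anisotropic {Q : QuadraticForm F V} (hQ : Q.Anisotropic)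
    {u v : V} (h : Q v = Q u) : ∃ g : quadIsometryGroup Q, g.1 u = v := by
  by_cases huv : u - v = 0
  · exact ⟨1, sub_eq_zero.1 huv⟩
  · have hz : Q (u - v) ≠ 0 := fun h => huv (hQ _ h)
    refine ⟨quadReflection Q hz, ?_⟩
    have : polar Q (u - v) u = Q (u - v) := by
      have := map_smul_add_smul_add Q 1 (-1) u v 0
      rw [show u - v = (1 : F) • u + (-1 : F) • v + 0 by module, this, add_zero, polar_add_left,
        polar_smul_left, polar_smul_left, polar_self_eq, h, polar_comm Q v u]
      simp
      ring
    rw [quadReflection_apply, this, inv_mul_cancel₀ hz, one_smul, sub_sub_cancel]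

/-- Since `g` fixes `u`, it moves any `w` by a vector orthogonal to `u`, hence by some `t • z`.
Preserving `Q w` is a quadratic equation in `t` whose roots correspond to the identity and the
reflection. -/
theorem eq_one_or_eq_quadReflection (hV : finrank F V = 2) {Q : QuadraticForm F V} {u z : V}
    (hu : u ≠ 0) (hz0 : z ≠ 0) (hz : Q z ≠ 0) (huz : polar Q u z = 0)
    (hnd : ∃ w, polar Q u w = 1) (g : quadIsometryGroup Q) (hg : g.1 u = u) :
    g = 1 ∨ g = quadReflection Q hz := by
  have : FiniteDimensional F V := Module.finite_of_finrank_pos (by omega)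
  -- The pair `u`, `z` need not be a basis: in characteristic 2, `z` is a multiple of `u`.
  obtain ⟨w, hw⟩ := exists_not_smul hV u
  obtain ⟨e, he⟩ := exists_plane_coordinates hV hu hw
  have hext : ∀ g h : quadIsometryGroup Q, g.1 u = u → h.1 u = u → g.1 w = h.1 w → g = h := by
    intro g h hg hh hgh
    refine Subtype.ext (LinearEquiv.ext fun v => ?_)
    obtain ⟨p, rfl⟩ := e.surjective v
    simp [he, hg, hh, hgh]
  have hpolar : ∀ v, polar Q u (g.1 v) = polar Q u v := fun v => by
    conv_lhs => rw [← hg]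
    simp only [polar, ← map_add]
    rw [g.2, g.2, g.2]
  obtain ⟨t, ht⟩ : ∃ t : F, t • z = g.1 w - w := by
    have h1 : finrank F (LinearMap.ker (Q.polarBilin u)) = 1 := by
      have h2 := LinearMap.finrank_range_add_finrank_ker (Q.polarBilin u)
      have h3 : LinearMap.range (Q.polarBilin u) = ⊤ := by
        rw [LinearMap.range_eq_top]
        intro c
        obtain ⟨w, hw⟩ := hnd
        exact ⟨c • w, by simp [hw]⟩
      rw [h3, finrank_top, finrank_self, hV] at h2
      omega
    obtain ⟨t, ht⟩ := (finrank_eq_one_iff_of_nonzero' (⟨z, by simpa using huz⟩ :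
      LinearMap.ker (Q.polarBilin u)) (fun h => hz0 (congrArg Subtype.val h))).1 h1
      ⟨g.1 w - w, by simp [polar_sub_right, hpolar]⟩
    exact ⟨t, congrArg Subtype.val ht⟩
  have hgw : g.1 w = t • z + (0 : F) • 0 + w := by rw [ht]; module
  have hq := g.2 w
  rw [hgw, map_smul_add_smul_add] at hq
  simp only [zero_mul, mul_zero, add_zero] at hq
  have hq' : t * (t * Q z + polar Q z w) = 0 := by linear_combination hq
  rcases mul_eq_zero.1 hq' with h0 | h0
  · left
    refine hext _ _ hg rfl ?_
    rw [hgw, h0]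
    simp
  · right
    refine hext _ _ hg ?_ ?_
    · rw [quadReflection_apply, polar_comm, huz]
      simp
    · have : t = -((Q z)⁻¹ * polar Q z w) := by
        field_simp
        linear_combination h0
      rw [quadReflection_apply, hgw, this]
      module

/-- Orbit-stabilizer: the orbit of `u` is the set of all `q + 1` vectors of its value, and its
stabilizer has order 2. -/
theorem card_quadIsometryGroup_of_anisotropic_plane [Finite F] (hV : finrank F V = 2)
    {Q : QuadraticForm F V} (hQ : Q.Anisotropic) :
    Nat.card (quadIsometryGroup Q) = 2 * (Nat.card F + 1) := by
  have : Nontrivial V := Module.nontrivial_of_finrank_pos (R := F) (by omega)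
  obtain ⟨u, hu⟩ := exists_ne (0 : V)
  have hQu : Q u ≠ 0 := fun h => hu (hQ u h)
  obtain ⟨z, hz0, huz⟩ := exists_polar_eq_zero hV Q u
  have hz : Q z ≠ 0 := fun h => hz0 (hQ z h)
  rw [card_eq_ncard_orbit_mul_card_stabilizer u]
  have horb : MulAction.orbit (quadIsometryGroup Q) u = {v | Q v = Q u} := by
    ext v
    constructor
    · rintro ⟨g, rfl⟩
      exact g.2 u
    · intro hv
      obtain ⟨g, hg⟩ := exists_isometry_apply_eq_of_anisotropic hQ hv
      exact ⟨g, hg⟩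
  have hstab : (MulAction.stabilizer (quadIsometryGroup Q) u : Set (quadIsometryGroup Q)) =
      {1, quadReflection Q hz} := by
    ext g
    constructor
    · exact fun hg => eq_one_or_eq_quadReflection hV hu hz0 hz huz (exists_polar_eq_one hV hQ hu)
        g hg
    · rintro (rfl | rfl)
      · exact one_mem _
      · change (quadReflection Q hz).1 u = u
        rw [quadReflection_apply, polar_comm, huz]
        simp
  have hne : (1 : quadIsometryGroup Q) ≠ quadReflection Q hz := by
    intro h
    obtain ⟨w, hw⟩ := exists_polar_eq_one hV hQ hz0
    have := congrArg (fun g : quadIsometryGroup Q => g.1 w) h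
    simp only [quadReflection_apply, hw, mul_one] at this
    have h0 : (Q z)⁻¹ • z = 0 := sub_eq_self.1 this.symm
    rw [smul_eq_zero] at h0
    exact h0.elim (inv_ne_zero hz) hz0
  rw [horb, ← SetLike.coe_sort_coe, Nat.card_coe_set_eq, hstab, Set.ncard_pair hne,
    ← Nat.card_coe_set_eq, mul_comm]
  exact congrArg _ (card_eq_of_anisotropic_plane hV hQ hQu)

end GroupOrder

/-! ### Isometry classes in even dimension and the sign -/

section EvenDimension

open Module QuadraticMap

variable {F V V' : Type*} [Field F] [AddCommGroup V] [Module F V] [AddCommGroup V'] [Module F V']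

/-- An even-dimensional quadratic form is zero-dimensional, an anisotropic plane, or has a nonzero
singular vector. -/
theorem even_finrank_cases [Finite F] (Q : QuadraticForm F V) {m : ℕ} (hV : finrank F V = 2 * m) :
    m = 0 ∨ (m = 1 ∧ Q.Anisotropic) ∨ ∃ u, Q u = 0 ∧ u ≠ 0 := by
  by_cases h : ∃ u, Q u = 0 ∧ u ≠ 0
  · exact Or.inr (Or.inr h)
  · have hm : ¬ 2 ≤ m := fun hm => h (exists_singular_of_three_le_finrank Q (by omega))
    push Not at h
    have : m = 0 ∨ m = 1 := by omega
    exact this.imp id fun h1 => Or.inl ⟨h1, fun v hv => h v hv⟩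

/-- Nonsingular forms of equal even dimension over a finite field are isometric as soon as they
have the same number of singular vectors. -/
theorem exists_isometryEquiv_of_zeroCount_eq [Finite F] (m : ℕ) : ∀ {V V' : Type*}
    [AddCommGroup V] [Module F V] [AddCommGroup V'] [Module F V'] [FiniteDimensional F V]
    [FiniteDimensional F V'] (Q : QuadraticForm F V) (Q' : QuadraticForm F V'),
    finrank F V = 2 * m → finrank F V' = 2 * m → IsNonsingularQuad Q → IsNonsingularQuad Q' →
    zeroCount Q = zeroCount Q' → Nonempty (Q.IsometryEquiv Q') := by
  induction m with
  | zero =>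
    intro V V' _ _ _ _ _ _ Q Q' hV hV' _ _ _
    have := finrank_zero_iff.1 hV
    refine ⟨⟨LinearEquiv.ofFinrankEq V V' (by omega), fun v => ?_⟩⟩
    rw [Subsingleton.elim v 0]
    simp
  | succ m ih =>
    intro V V' _ _ _ _ _ _ Q Q' hV hV' hQ hQ' hZ
    have : Finite V := Module.finite_of_finite F
    have : Finite V' := Module.finite_of_finite F
    rcases even_finrank_cases Q hV with h | ⟨h, han⟩ | ⟨u, hu, hu0⟩
    · omega
    · have han' := anisotropic_of_zeroCount_eq_one
        (hZ.symm.trans (zeroCount_eq_one_of_anisotropic han))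
      exact exists_isometryEquiv_of_anisotropic_plane (by omega) (by omega) han han'
    · obtain ⟨u', hu', hu0'⟩ := exists_singular_of_zeroCount_ne_one (Q := Q') fun h =>
        hu0 (anisotropic_of_zeroCount_eq_one (hZ.trans h) u hu)
      obtain ⟨K, hK, hd, ⟨e⟩⟩ := hQ.exists_split hu hu0
      obtain ⟨K', hK', hd', ⟨e'⟩⟩ := hQ'.exists_split hu' hu0'
      -- Equal zero counts descend to the complements of the hyperbolic planes.
      have h1 := zeroCount_hyperbolicSum (Q.comp K.subtype)
      have h2 := zeroCount_hyperbolicSum (Q'.comp K'.subtype)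
      rw [zeroCount_eq e, Module.natCard_eq_pow_finrank (K := F)] at h1
      rw [zeroCount_eq e', ← hZ, Module.natCard_eq_pow_finrank (K := F),
        show finrank F K' = finrank F K by omega] at h2
      have h3 := Nat.eq_of_mul_eq_mul_left Nat.card_pos (h1.symm.trans h2)
      obtain ⟨g⟩ := ih (Q.comp K.subtype) (Q'.comp K'.subtype) (by omega) (by omega) hK hK'
        (by omega)
      exact ⟨(e.symm.trans (hyperbolicSumCongr g)).trans e'⟩

/-- The count of singular vectors which defines the sign `ε = ±1` of a quadratic form in dimension
`2 * m`. -/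
def HasWittSign (Q : QuadraticForm F V) (m : ℕ) (ε : ℤ) : Prop :=
  (Nat.card F : ℤ) * zeroCount Q =
    (Nat.card F : ℤ) ^ (2 * m) + ε * (Nat.card F - 1) * (Nat.card F : ℤ) ^ m

/-- The recursion for zero counts preserves the formula with the same `ε`. The factor `Nat.card F`
in the definition avoids an exponent `m - 1`, so that `m = 0` is covered. -/
theorem hasWittSign_hyperbolicSum [Finite F] [FiniteDimensional F V] {Q : QuadraticForm F V}
    {m : ℕ} (hV : finrank F V = 2 * m) {ε : ℤ} :
    HasWittSign (hyperbolicSum Q) (m + 1) ε ↔ HasWittSign Q m ε := by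
  have h := zeroCount_hyperbolicSum Q
  rw [Module.natCard_eq_pow_finrank (K := F), hV] at h
  have hq : (Nat.card F : ℤ) ≠ 0 := by exact_mod_cast Nat.card_pos.ne'
  zify at h
  rw [HasWittSign, HasWittSign, eq_sub_of_add_eq h]
  constructor <;> intro h'
  · apply mul_left_cancel₀ hq
    linear_combination h'
  · linear_combination (Nat.card F : ℤ) * h'

theorem hasWittSign_congr {Q : QuadraticForm F V} {Q' : QuadraticForm F V'}
    (e : Q.IsometryEquiv Q') {m : ℕ} {ε : ℤ} : HasWittSign Q m ε ↔ HasWittSign Q' m ε := by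
  rw [HasWittSign, HasWittSign, zeroCount_eq e]

theorem hasWittSign_zero [FiniteDimensional F V] (Q : QuadraticForm F V)
    (hV : finrank F V = 0) : HasWittSign Q 0 1 := by
  have := finrank_zero_iff.1 hV
  rw [HasWittSign, zeroCount_eq_one_of_anisotropic (fun v _ => Subsingleton.elim v 0)]
  simp

theorem hasWittSign_of_anisotropic_plane {Q : QuadraticForm F V} (hQ : Q.Anisotropic) :
    HasWittSign Q 1 (-1) := by
  rw [HasWittSign, zeroCount_eq_one_of_anisotropic hQ]
  push_cast
  ring

theorem hasWittSign_one_or_neg_one [Finite F] (m : ℕ) : ∀ {V : Type*} [AddCommGroup V]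
    [Module F V] [FiniteDimensional F V] (Q : QuadraticForm F V), finrank F V = 2 * m →
    IsNonsingularQuad Q → HasWittSign Q m 1 ∨ HasWittSign Q m (-1) := by
  induction m with
  | zero => exact fun Q hV _ => Or.inl (hasWittSign_zero Q hV)
  | succ m ih =>
    intro V _ _ _ Q hV hQ
    rcases even_finrank_cases Q hV with h | ⟨h, han⟩ | ⟨u, hu, hu0⟩
    · omega
    · obtain rfl : m = 0 := by omega
      exact Or.inr (hasWittSign_of_anisotropic_plane han)
    · obtain ⟨K, hK, hd, ⟨e⟩⟩ := hQ.exists_split hu hu0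
      rw [← hasWittSign_congr e, ← hasWittSign_congr e, hasWittSign_hyperbolicSum (by omega),
        hasWittSign_hyperbolicSum (by omega)]
      exact ih _ (by omega) hK

theorem HasWittSign.unique [Finite F] {Q : QuadraticForm F V} {m : ℕ}
    (h : HasWittSign Q m 1) : ¬ HasWittSign Q m (-1) := by
  intro h'
  have hq : (1 : ℤ) < Nat.card F := by exact_mod_cast Finite.one_lt_card
  have : 0 < ((Nat.card F : ℤ) - 1) * (Nat.card F : ℤ) ^ m := by
    have : 0 < (Nat.card F : ℤ) - 1 := by omega
    positivity
  rw [HasWittSign] at h h'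
  linarith

theorem exists_isometryEquiv_of_hasWittSign [Finite F] [FiniteDimensional F V]
    [FiniteDimensional F V'] {Q : QuadraticForm F V} {Q' : QuadraticForm F V'} {m : ℕ} {ε : ℤ}
    (hV : finrank F V = 2 * m) (hV' : finrank F V' = 2 * m) (hQ : IsNonsingularQuad Q)
    (hQ' : IsNonsingularQuad Q') (h : HasWittSign Q m ε) (h' : HasWittSign Q' m ε) :
    Nonempty (Q.IsometryEquiv Q') := by
  refine exists_isometryEquiv_of_zeroCount_eq m Q Q' hV hV' hQ hQ' ?_
  have hq : (Nat.card F : ℤ) ≠ 0 := by exact_mod_cast Nat.card_pos.ne'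
  exact_mod_cast mul_left_cancel₀ hq (h.trans h'.symm)

end EvenDimension

/-! ### Orders of the groups in even dimension -/

section GroupOrderEven

open Module QuadraticMap

variable {F V V' : Type*} [Field F] [AddCommGroup V] [Module F V] [AddCommGroup V'] [Module F V']

/-- The partners of a singular vector in hyperbolic pairs. -/
theorem card_hyperbolic_partners {Q : QuadraticForm F V} (hQ : IsNonsingularQuad Q)
    [FiniteDimensional F V] {u : V} (hu : Q u = 0) (hu0 : u ≠ 0) {d : ℕ}
    (hV : finrank F V = d + 2) :
    Nat.card {w : V // Q w = 0 ∧ polar Q u w = 1} = Nat.card F ^ d := by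
  obtain ⟨w, hw, huw⟩ := hQ.exists_hyperbolic_pair hu hu0
  let e := hyperbolicSplit Q hu hw huw
  have he : e (1, 0, 0) = u := by simp [e]
  have hd : finrank F (pairComplement Q u w) = d := by
    have := finrank_eq_of_isometryEquiv e
    rw [finrank_hyperbolicSum] at this
    omega
  have hpolar : ∀ p, polar Q u (e p) = p.2.1 := fun p => by
    have h := polar_isometryEquiv e (1, 0, 0) p
    rw [he] at h
    rw [h, polar_hyperbolicSum]
    simp
  rw [← hd, ← Module.natCard_eq_pow_finrank]
  -- In split coordinates `(x, y, k)`, product 1 with `u` forces `y = 1`, singularity forces `x = -Q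
  -- k`, and `k` is free.
  refine Nat.card_congr
    { toFun := fun x => (e.symm x.1).2.2
      invFun := fun k => ⟨e (-Q k, 1, k), by simp [e.map_app], by rw [hpolar]⟩
      left_inv := ?_
      right_inv := fun k => by simp }
  rintro ⟨x, hx, hux⟩
  obtain ⟨⟨a, b, k⟩, rfl⟩ := e.toLinearEquiv.surjective x
  have hb : b = 1 := (hpolar (a, b, k)).symm.trans hux
  have ha : a * b + Q k = 0 := (e.map_app (a, b, k)).symm.trans hx
  subst hb
  have ha' : -Q k = a := by linear_combination -ha
  apply Subtype.ext
  simp [ha']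

theorem card_nonzero_singular [Finite V] (Q : QuadraticForm F V) :
    Nat.card {u : V // Q u = 0 ∧ u ≠ 0} + 1 = zeroCount Q := by
  classical
  rw [zeroCount, ← Finite.card_option]
  exact Nat.card_congr
    { toFun := fun s => s.elim ⟨0, by simp⟩ fun u => ⟨u.1, u.2.1⟩
      invFun := fun v => if h : v.1 = 0 then none else some ⟨v.1, v.2, h⟩
      left_inv := by
        rintro (_ | ⟨u, hu, hu0⟩)
        · simp
        · simp [hu0]
      right_inv := by
        rintro ⟨v, hv⟩
        by_cases h : v = 0
        · simp [h]
        · simp [h] }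

/-- The hyperbolic pairs of a quadratic space. -/
def hyperbolicPairs (Q : QuadraticForm F V) : Set (V × V) :=
  {p | Q p.1 = 0 ∧ Q p.2 = 0 ∧ polar Q p.1 p.2 = 1}

theorem ncard_hyperbolicPairs [Finite F] [FiniteDimensional F V] {Q : QuadraticForm F V}
    (hQ : IsNonsingularQuad Q) {d : ℕ} (hV : finrank F V = d + 2) :
    (hyperbolicPairs Q).ncard + Nat.card F ^ d = zeroCount Q * Nat.card F ^ d := by
  have : Finite V := Module.finite_of_finite F
  have := Fintype.ofFinite {u : V // Q u = 0 ∧ u ≠ 0}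
  have e : hyperbolicPairs Q ≃
      Σ u : {u : V // Q u = 0 ∧ u ≠ 0}, {w : V // Q w = 0 ∧ polar Q u.1 w = 1} :=
    { toFun := fun p => ⟨⟨p.1.1, p.2.1, fun h => by
        have := p.2.2.2
        rw [h, polar_zero_left] at this
        exact zero_ne_one this⟩, ⟨p.1.2, p.2.2⟩⟩
      invFun := fun s => ⟨(s.1.1, s.2.1), s.1.2.1, s.2.2⟩
      left_inv := fun p => rfl
      right_inv := fun s => rfl }
  rw [← Nat.card_coe_set_eq, Nat.card_congr e, Nat.card_sigma, ← card_nonzero_singular Q,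
    Finset.sum_congr rfl fun u _ => card_hyperbolic_partners hQ u.2.1 u.2.2 hV, Finset.sum_const,
    Finset.card_univ, ← Nat.card_eq_fintype_card, smul_eq_mul]
  ring

/-- The standard hyperbolic pair of a sum with a hyperbolic plane. -/
def standardPair (F V : Type*) [Field F] [AddCommGroup V] [Module F V] :
    (F × F × V) × (F × F × V) := ((1, 0, 0), (0, 1, 0))

/-- Transitivity on hyperbolic pairs: the complement of any pair has the dimension and zero count of
`Q`, hence is isometric to it, and such an isometry extends over the planes. -/
theorem orbit_standardPair [Finite F] [FiniteDimensional F V] {Q : QuadraticForm F V}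
    (hQ : IsNonsingularQuad Q) {m : ℕ} (hV : finrank F V = 2 * m) :
    MulAction.orbit (quadIsometryGroup (hyperbolicSum Q)) (standardPair F V) =
      hyperbolicPairs (hyperbolicSum Q) := by
  ext ⟨u, w⟩
  constructor
  · rintro ⟨g, hg⟩
    have h1 : g.1 (1, 0, 0) = u := congrArg Prod.fst hg
    have h2 : g.1 (0, 1, 0) = w := congrArg Prod.snd hg
    refine ⟨?_, ?_, ?_⟩
    · rw [← h1, g.2]
      simp
    · rw [← h2, g.2]
      simp
    · simp only
      rw [← h1, ← h2, polar, ← map_add, g.2, g.2, g.2]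
      simp
  · rintro ⟨hu, hw, huw⟩
    let e := hyperbolicSplit (hyperbolicSum Q) hu hw huw
    have hdim := finrank_eq_of_isometryEquiv e
    rw [finrank_hyperbolicSum, finrank_hyperbolicSum] at hdim
    have hns := isNonsingularQuad_hyperbolicSum.1
      ((isNonsingularQuad_hyperbolicSum.2 hQ).of_isometryEquiv e.symm)
    have hK := zeroCount_hyperbolicSum
      ((hyperbolicSum Q).comp (pairComplement (hyperbolicSum Q) u w).subtype)
    rw [zeroCount_eq e, Module.natCard_eq_pow_finrank (K := F), Nat.add_right_cancel hdim,
      ← Module.natCard_eq_pow_finrank (K := F), zeroCount_hyperbolicSum] at hK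
    have hZ := Nat.add_right_cancel (Nat.eq_of_mul_eq_mul_left Nat.card_pos hK)
    obtain ⟨g⟩ := exists_isometryEquiv_of_zeroCount_eq m Q _ hV (by omega) hQ hns hZ
    let t := (hyperbolicSumCongr g).trans e
    refine ⟨⟨t.toLinearEquiv, fun v => t.map_app v⟩, Prod.ext ?_ ?_⟩
    · change e (hyperbolicSumCongr g (1, 0, 0)) = u
      simp [e]
    · change e (hyperbolicSumCongr g (0, 1, 0)) = w
      simp [e]

/-- An isometry of the sum with a hyperbolic plane which fixes the standard hyperbolic pair acts
on the other summand. -/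
theorem apply_inr_of_mem_stabilizer_standardPair {Q : QuadraticForm F V}
    {g : quadIsometryGroup (hyperbolicSum Q)}
    (hg : g ∈ MulAction.stabilizer (quadIsometryGroup (hyperbolicSum Q)) (standardPair F V))
    (k : V) : g.1 (0, 0, k) = (0, 0, (g.1 (0, 0, k)).2.2) := by
  have h1 : g.1 (1, 0, 0) = (1, 0, 0) := congrArg Prod.fst hg
  have h2 : g.1 (0, 1, 0) = (0, 1, 0) := congrArg Prod.snd hg
  have hp : ∀ v w, polar (hyperbolicSum Q) (g.1 v) (g.1 w) = polar (hyperbolicSum Q) v w :=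
    fun v w => by simp only [polar, ← map_add]; rw [g.2, g.2, g.2]
  -- The image stays orthogonal to both fixed vectors, and each of these products reads off one
  -- hyperbolic coordinate.
  have e1 := hp (0, 0, k) (1, 0, 0)
  have e2 := hp (0, 0, k) (0, 1, 0)
  rw [h1, polar_hyperbolicSum, polar_hyperbolicSum] at e1
  rw [h2, polar_hyperbolicSum, polar_hyperbolicSum] at e2
  refine Prod.ext ?_ (Prod.ext ?_ rfl)
  · simpa using e2
  · simpa using e1

theorem apply_of_mem_stabilizer_standardPair {Q : QuadraticForm F V}
    (g : quadIsometryGroup (hyperbolicSum Q))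
    (hg : g ∈ MulAction.stabilizer (quadIsometryGroup (hyperbolicSum Q)) (standardPair F V))
    (p : F × F × V) : g.1 p = (p.1, p.2.1, (g.1 (0, 0, p.2.2)).2.2) := by
  have h1 : g.1 (1, 0, 0) = (1, 0, 0) := congrArg Prod.fst hg
  have h2 : g.1 (0, 1, 0) = (0, 1, 0) := congrArg Prod.snd hg
  have hp : p = p.1 • ((1, 0, 0) : F × F × V) + p.2.1 • ((0, 1, 0) : F × F × V) +
    (0, 0, p.2.2) := by simp
  conv_lhs => rw [hp, map_add, map_add, map_smul, map_smul, h1, h2,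
    apply_inr_of_mem_stabilizer_standardPair hg]
  simp

/-- The stabilizer of the standard hyperbolic pair is the isometry group of the other summand. -/
def stabilizerStandardPairEquiv (Q : QuadraticForm F V) :
    MulAction.stabilizer (quadIsometryGroup (hyperbolicSum Q)) (standardPair F V) ≃
      quadIsometryGroup Q where
  toFun g :=
    ⟨{ toFun := fun k => (g.1.1 (0, 0, k)).2.2
       invFun := fun k => ((g⁻¹).1.1 (0, 0, k)).2.2
       left_inv := fun k => by
        dsimp only
        rw [← apply_inr_of_mem_stabilizer_standardPair g.2]
        change (g.1.1.symm (g.1.1 (0, 0, k))).2.2 = k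
        simp
       right_inv := fun k => by
        dsimp only
        rw [← apply_inr_of_mem_stabilizer_standardPair (g⁻¹).2]
        change (g.1.1 (g.1.1.symm (0, 0, k))).2.2 = k
        simp
       map_add' := fun k l => by
        rw [show ((0, 0, k + l) : F × F × V) = (0, 0, k) + (0, 0, l) by simp, map_add]
        rfl
       map_smul' := fun c k => by
        rw [show ((0, 0, c • k) : F × F × V) = c • (0, 0, k) by simp, map_smul]
        rfl }, fun k => by
        have h := g.1.2 (0, 0, k)
        rw [apply_inr_of_mem_stabilizer_standardPair g.2] at h
        simpa using h⟩
  invFun h := ⟨⟨(LinearEquiv.refl F F).prodCongr ((LinearEquiv.refl F F).prodCongr h.1), fun p => by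
    have := h.2 p.2.2
    simp [this]⟩, by
    rw [MulAction.mem_stabilizer_iff]
    refine Prod.ext ?_ ?_
    · change ((1 : F), (0 : F), h.1 0) = (1, 0, 0)
      rw [map_zero]
    · change ((0 : F), (1 : F), h.1 0) = (0, 1, 0)
      rw [map_zero]⟩
  left_inv g := by
    refine Subtype.ext (Subtype.ext (LinearEquiv.ext fun p => ?_))
    rw [apply_of_mem_stabilizer_standardPair g.1 g.2 p]
    rfl
  right_inv h := rfl

theorem card_quadIsometryGroup_hyperbolicSum [Finite F] [FiniteDimensional F V]
    {Q : QuadraticForm F V} (hQ : IsNonsingularQuad Q) {m : ℕ} (hV : finrank F V = 2 * m) :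
    (Nat.card (quadIsometryGroup (hyperbolicSum Q)) : ℤ) =
      (zeroCount (hyperbolicSum Q) - 1) * (Nat.card F : ℤ) ^ (2 * m) *
        Nat.card (quadIsometryGroup Q) := by
  rw [card_eq_ncard_orbit_mul_card_stabilizer (standardPair F V), orbit_standardPair hQ hV,
    Nat.card_congr (stabilizerStandardPairEquiv Q)]
  have h := ncard_hyperbolicPairs (isNonsingularQuad_hyperbolicSum.2 hQ) (d := 2 * m)
    (by rw [finrank_hyperbolicSum, hV])
  zify at h
  rw [Nat.cast_mul, eq_sub_of_add_eq h]
  ring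

/-- The product of the order of an orthogonal group in dimension `2 * m` and `q ^ m + ε` does not
depend on the sign `ε`. -/
def orthogonalOrderFactor (q : ℤ) : ℕ → ℤ
  | 0 => 2
  | m + 1 => (q ^ (2 * (m + 1)) - 1) * q ^ (2 * m) * orthogonalOrderFactor q m

/-- In dimension `2 (m + 1)` the sign formula says that the number of nonzero singular vectors is
`(q^(m+1) - ε) (q^m + ε)`. Multiplying the recursion for the order by `q^(m+1) + ε` turns the first
factor into `q^(2(m+1)) - 1`, and the second is absorbed by induction. -/
theorem card_quadIsometryGroup_mul [Finite F] (m : ℕ) : ∀ {V : Type*} [AddCommGroup V]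
    [Module F V] [FiniteDimensional F V] (Q : QuadraticForm F V) (ε : ℤ),
    finrank F V = 2 * m → IsNonsingularQuad Q → ε = 1 ∨ ε = -1 → HasWittSign Q m ε →
    (Nat.card (quadIsometryGroup Q) : ℤ) * ((Nat.card F : ℤ) ^ m + ε) =
      orthogonalOrderFactor (Nat.card F) m := by
  induction m with
  | zero =>
    intro V _ _ _ Q ε hV hQ hε h
    have := finrank_zero_iff.1 hV
    have hε1 : ε = 1 := hε.resolve_right fun h' =>
      (hasWittSign_zero Q hV).unique (h' ▸ h)
    have h1 : Nat.card (quadIsometryGroup Q) = 1 := by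
      rw [Nat.card_eq_one_iff_unique]
      refine ⟨⟨fun g h => Subtype.ext (LinearEquiv.ext fun v => Subsingleton.elim _ _)⟩, ⟨1⟩⟩
    rw [h1, hε1]
    rfl
  | succ m ih =>
    intro V _ _ _ Q ε hV hQ hε h
    rcases even_finrank_cases Q hV with h0 | ⟨h1, han⟩ | ⟨u, hu, hu0⟩
    · omega
    · obtain rfl : m = 0 := by omega
      have hε1 : ε = -1 := hε.resolve_left fun h' =>
        (h' ▸ h : HasWittSign Q 1 1).unique (hasWittSign_of_anisotropic_plane han)
      rw [card_quadIsometryGroup_of_anisotropic_plane hV han, hε1]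
      simp only [orthogonalOrderFactor]
      push_cast
      ring
    · obtain ⟨K, hK, hd, ⟨e⟩⟩ := hQ.exists_split hu hu0
      have hKd : finrank F K = 2 * m := by omega
      rw [← hasWittSign_congr e] at h
      have h1 := ih _ ε hKd hK hε ((hasWittSign_hyperbolicSum hKd).1 h)
      rw [← card_quadIsometryGroup_eq e, card_quadIsometryGroup_hyperbolicSum hK hKd]
      have hq : (Nat.card F : ℤ) ≠ 0 := by exact_mod_cast Nat.card_pos.ne'
      have hε2 : ε ^ 2 = 1 := by rcases hε with rfl | rfl <;> rfl
      apply mul_left_cancel₀ hq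
      simp only [orthogonalOrderFactor]
      rw [← h1]
      rw [HasWittSign] at h
      linear_combination (Nat.card F : ℤ) ^ (2 * m) * Nat.card (quadIsometryGroup (Q.comp K.subtype)) *
        ((Nat.card F : ℤ) ^ (m + 1) + ε) * h + (Nat.card F : ℤ) ^ (2 * m) *
        Nat.card (quadIsometryGroup (Q.comp K.subtype)) * ((Nat.card F : ℤ) ^ 2 - Nat.card F) *
        (Nat.card F : ℤ) ^ m * hε2

/-- Equal orders, finite and so nonzero in `Nat.card`, would cancel to `q^m + 1 = q^m - 1`. -/
theorem not_nonempty_mulEquiv_of_hasWittSign [Finite F] [FiniteDimensional F V]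
    [FiniteDimensional F V'] {Q : QuadraticForm F V} {Q' : QuadraticForm F V'} {m : ℕ}
    (hV : finrank F V = 2 * m) (hV' : finrank F V' = 2 * m) (hQ : IsNonsingularQuad Q)
    (hQ' : IsNonsingularQuad Q') (h : HasWittSign Q m 1) (h' : HasWittSign Q' m (-1)) :
    ¬ Nonempty (quadIsometryGroup Q ≃* quadIsometryGroup Q') := by
  rintro ⟨e⟩
  have h1 := card_quadIsometryGroup_mul m Q 1 hV hQ (Or.inl rfl) h
  have h2 := card_quadIsometryGroup_mul m Q' (-1) hV' hQ' (Or.inr rfl) h'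
  have : Finite V := Module.finite_of_finite F
  have : Finite (V ≃ₗ[F] V) := Finite.of_injective (fun g v => g v) fun g h hgh =>
    LinearEquiv.ext (congrFun hgh)
  rw [← Nat.card_congr e.toEquiv, ← h1] at h2
  have hpos : (0 : ℤ) < Nat.card (quadIsometryGroup Q) := by exact_mod_cast Nat.card_pos
  have := mul_left_cancel₀ hpos.ne' h2
  linarith

end GroupOrderEven

/-! ### Plus type means sign `1` -/

section PlusType

open Module QuadraticMap

variable {F V V' : Type*} [Field F] [AddCommGroup V] [Module F V] [AddCommGroup V'] [Module F V']

theorem isPlusQuad_hyperbolicSum [FiniteDimensional F V] {Q : QuadraticForm F V}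
    (h : IsPlusQuad Q) : IsPlusQuad (hyperbolicSum Q) := by
  obtain ⟨W, hW, hQ⟩ := h
  let l : (F × W) →ₗ[F] (F × F × V) :=
    (LinearMap.fst F F W).prod ((0 : (F × W) →ₗ[F] F).prod (W.subtype.comp (LinearMap.snd F F W)))
  have hl : ∀ p, l p = (p.1, 0, (p.2 : V)) := fun p => rfl
  have hinj : Function.Injective l := fun p r h => by
    rw [hl, hl, Prod.mk.injEq, Prod.mk.injEq] at h
    exact Prod.ext h.1 (Subtype.ext h.2.2)
  refine ⟨LinearMap.range l, ?_, ?_⟩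
  · rw [LinearMap.finrank_range_of_inj hinj, finrank_hyperbolicSum, finrank_prod, finrank_self]
    omega
  · rintro _ ⟨p, rfl⟩
    simp [hl, hQ p.2 p.2.2]

/-- A maximal totally singular subspace restricts to the complement of a hyperbolic pair whose
first vector it contains. -/
theorem isPlusQuad_pairComplement [FiniteDimensional F V] {Q : QuadraticForm F V} {m : ℕ}
    (hV : finrank F V = 2 * (m + 1)) {W : Submodule F V} (hW : 2 * finrank F W = finrank F V)
    (hQW : ∀ x ∈ W, Q x = 0) {u w : V} (huW : u ∈ W) (huw : polar Q u w = 1)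
    (hK : finrank F (pairComplement Q u w) = 2 * m) :
    IsPlusQuad (Q.comp (pairComplement Q u w).subtype) := by
  -- The subspace sought is the part of `W` orthogonal to `w`. It is orthogonal to `u` because `Q`
  -- vanishes on `W`, and its dimension is one less because `polar Q w u = 1`.
  let φ : W →ₗ[F] F := (Q.polarBilin w).comp W.subtype
  have hφ : LinearMap.range φ = ⊤ := by
    rw [LinearMap.range_eq_top]
    intro c
    refine ⟨c • ⟨u, huW⟩, ?_⟩
    simp [φ, polar_comm Q w u, huw]
  have hker : finrank F (LinearMap.ker φ) = m := by
    have h := LinearMap.finrank_range_add_finrank_ker φ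
    rw [hφ, finrank_top, finrank_self] at h
    omega
  let l : LinearMap.ker φ →ₗ[F] pairComplement Q u w :=
    LinearMap.codRestrict _ (W.subtype.comp (LinearMap.ker φ).subtype) fun x => by
      refine mem_pairComplement.2 ⟨?_, x.2⟩
      have hx : (x.1 : V) ∈ W := x.1.2
      simp [polar, hQW _ (W.add_mem huW hx), hQW _ huW, hQW _ hx]
  have hinj : Function.Injective l := fun x y h =>
    Subtype.ext (Subtype.ext (congrArg (fun k : pairComplement Q u w => (k : V)) h))
  refine ⟨LinearMap.range l, ?_, ?_⟩
  · rw [LinearMap.finrank_range_of_inj hinj, hker, hK]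
  · rintro _ ⟨x, rfl⟩
    exact hQW _ x.1.2

/-- Both properties pass through the splitting of a hyperbolic plane whose first vector, when `W` is
given, is taken in `W`. Both hold in dimension 0, and an anisotropic plane has sign `-1`. -/
theorem isPlusQuad_iff_hasWittSign [Finite F] (m : ℕ) : ∀ {V : Type*} [AddCommGroup V]
    [Module F V] [FiniteDimensional F V] (Q : QuadraticForm F V), finrank F V = 2 * m →
    IsNonsingularQuad Q → (IsPlusQuad Q ↔ HasWittSign Q m 1) := by
  induction m with
  | zero =>
    intro V _ _ _ Q hV hQ
    exact ⟨fun _ => hasWittSign_zero Q hV, fun _ => ⟨⊥, by simp [hV], by simp⟩⟩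
  | succ m ih =>
    intro V _ _ _ Q hV hQ
    constructor
    · rintro ⟨W, hW, hQW⟩
      have hW0 : W ≠ ⊥ := by
        rintro rfl
        rw [finrank_bot] at hW
        omega
      obtain ⟨u, huW, hu0⟩ := Submodule.exists_mem_ne_zero_of_ne_bot hW0
      obtain ⟨w, hw, huw⟩ := hQ.exists_hyperbolic_pair (hQW u huW) hu0
      let e := hyperbolicSplit Q (hQW u huW) hw huw
      have hd := finrank_eq_of_isometryEquiv e
      rw [finrank_hyperbolicSum] at hd
      have hK : finrank F (pairComplement Q u w) = 2 * m := by omega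
      rw [← hasWittSign_congr e, hasWittSign_hyperbolicSum hK]
      exact (ih _ hK (isNonsingularQuad_hyperbolicSum.1 (hQ.of_isometryEquiv e.symm))).1
        (isPlusQuad_pairComplement hV hW hQW huW huw hK)
    · intro h
      rcases even_finrank_cases Q hV with h0 | ⟨h1, han⟩ | ⟨u, hu, hu0⟩
      · omega
      · obtain rfl : m = 0 := by omega
        exact (h.unique (hasWittSign_of_anisotropic_plane han)).elim
      · obtain ⟨K, hK, hd, ⟨e⟩⟩ := hQ.exists_split hu hu0
        have hKd : finrank F K = 2 * m := by omega
        rw [← hasWittSign_congr e, hasWittSign_hyperbolicSum hKd] at h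
        exact (isPlusQuad_hyperbolicSum ((ih _ hKd hK).2 h)).of_isometryEquiv e

/-- In even dimension, the orthogonal groups of two nonsingular quadratic forms over a finite field
are isomorphic if and only if the forms are of the same type. -/
theorem nonempty_mulEquiv_iff_isPlusQuad_iff [Finite F] [FiniteDimensional F V]
    [FiniteDimensional F V'] {n : ℕ} (hn : Even n) {Q : QuadraticForm F V}
    {Q' : QuadraticForm F V'} (hV : finrank F V = n) (hV' : finrank F V' = n)
    (hQ : IsNonsingularQuad Q) (hQ' : IsNonsingularQuad Q') :
    Nonempty (quadIsometryGroup Q ≃* quadIsometryGroup Q') ↔ (IsPlusQuad Q ↔ IsPlusQuad Q') := by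
  obtain ⟨m, hm⟩ := hn
  rw [← two_mul] at hm
  subst hm
  have hiso : ∀ ε, HasWittSign Q m ε → HasWittSign Q' m ε →
      Nonempty (quadIsometryGroup Q ≃* quadIsometryGroup Q') := fun ε h h' => by
    obtain ⟨e⟩ := exists_isometryEquiv_of_hasWittSign hV hV' hQ hQ' h h'
    exact ⟨quadIsometryGroupCongr e.toLinearEquiv one_ne_zero
      fun v => by rw [one_mul]; exact e.map_app v⟩
  rw [isPlusQuad_iff_hasWittSign m Q hV hQ, isPlusQuad_iff_hasWittSign m Q' hV' hQ']
  rcases hasWittSign_one_or_neg_one m Q hV hQ with h | h <;>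
    rcases hasWittSign_one_or_neg_one m Q' hV' hQ' with h' | h'
  · simp only [h, h', hiso 1 h h']
  · have := not_nonempty_mulEquiv_of_hasWittSign hV hV' hQ hQ' h h'
    simp only [h, this, true_iff, false_iff]
    exact fun h1 => h1.unique h'
  · have := not_nonempty_mulEquiv_of_hasWittSign hV' hV hQ' hQ h' h
    have h1 : ¬ HasWittSign Q m 1 := fun h1 => h1.unique h
    simp only [h', h1, iff_true, iff_false]
    exact fun ⟨e⟩ => this ⟨e.symm⟩
  · have h1 : ¬ HasWittSign Q m 1 := fun h1 => h1.unique h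
    have h2 : ¬ HasWittSign Q' m 1 := fun h1 => h1.unique h'
    simp only [h1, h2, hiso _ h h']

end PlusType

/-! ### Existence of forms of each kind -/

section Existence

open Module QuadraticMap

variable (F : Type*) [Field F]

theorem exists_isometryEquiv_fin {F V : Type*} [Field F] [AddCommGroup V] [Module F V]
    [FiniteDimensional F V] (Q : QuadraticForm F V) {n : ℕ} (hV : finrank F V = n) :
    ∃ Q' : QuadraticForm F (Fin n → F), Nonempty (Q.IsometryEquiv Q') :=
  ⟨_, ⟨isometryEquivOfCompLinearEquiv Q (LinearEquiv.ofFinrankEq (Fin n → F) V (by simp [hV]))⟩⟩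

theorem exists_hyperbolicSum_fin {F : Type*} [Field F] {n : ℕ}
    (Q : QuadraticForm F (Fin n → F)) :
    ∃ Q' : QuadraticForm F (Fin (n + 2) → F), Nonempty ((hyperbolicSum Q).IsometryEquiv Q') :=
  exists_isometryEquiv_fin _ (by rw [finrank_hyperbolicSum, finrank_fin_fun])

/-- The map `x ↦ x² + x` identifies 0 and -1, so on a finite field it misses some `c`; then `x² + x
y - c y²` is anisotropic, in every characteristic. -/
theorem exists_anisotropic_plane [Finite F] : ∃ Q : QuadraticForm F (F × F), Q.Anisotropic := by
  obtain ⟨c, hc⟩ : ∃ c : F, ∀ x, x ^ 2 + x ≠ c := by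
    have h : ¬ Function.Surjective fun x : F => x ^ 2 + x := fun h => by
      have := Finite.injective_iff_surjective.2 h (a₁ := 0) (a₂ := -1) (by simp)
      simp at this
    simpa [Function.Surjective] using h
  refine ⟨linMulLin (LinearMap.fst F F F) (LinearMap.fst F F F) +
    linMulLin (LinearMap.fst F F F) (LinearMap.snd F F F) -
    c • linMulLin (LinearMap.snd F F F) (LinearMap.snd F F F), ?_⟩
  rintro ⟨x, y⟩ h
  simp only [sub_apply, add_apply, smul_apply,
    linMulLin_apply, LinearMap.fst_apply, LinearMap.snd_apply, smul_eq_mul] at h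
  by_cases hy : y = 0
  · subst hy
    have : x = 0 := by simpa using h
    simp [this]
  · refine (hc (x / y) ?_).elim
    field_simp
    linear_combination h

theorem exists_hasWittSign_one [Finite F] (m : ℕ) :
    ∃ Q : QuadraticForm F (Fin (2 * m) → F), IsNonsingularQuad Q ∧ HasWittSign Q m 1 := by
  induction m with
  | zero =>
    exact ⟨0, isNonsingularQuad_iff.2 fun v _ _ => funext fun i => absurd i.2 (by omega),
      hasWittSign_zero _ (by simp)⟩
  | succ m ih =>
    obtain ⟨Q, hQ, h⟩ := ih
    obtain ⟨Q', ⟨e⟩⟩ := exists_hyperbolicSum_fin Q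
    exact ⟨Q', (isNonsingularQuad_hyperbolicSum.2 hQ).of_isometryEquiv e,
      (hasWittSign_congr e).1 ((hasWittSign_hyperbolicSum (by simp)).2 h)⟩

theorem exists_hasWittSign_neg_one [Finite F] (m : ℕ) :
    ∃ Q : QuadraticForm F (Fin (2 * (m + 1)) → F),
      IsNonsingularQuad Q ∧ HasWittSign Q (m + 1) (-1) := by
  induction m with
  | zero =>
    obtain ⟨Q, hQ⟩ := exists_anisotropic_plane F
    obtain ⟨Q', ⟨e⟩⟩ := exists_isometryEquiv_fin Q (n := 2 * (0 + 1)) (by simp)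
    exact ⟨Q', (isNonsingularQuad_of_anisotropic hQ).of_isometryEquiv e,
      (hasWittSign_congr e).1 (hasWittSign_of_anisotropic_plane hQ)⟩
  | succ m ih =>
    obtain ⟨Q, hQ, h⟩ := ih
    obtain ⟨Q', ⟨e⟩⟩ := exists_hyperbolicSum_fin Q
    exact ⟨Q', (isNonsingularQuad_hyperbolicSum.2 hQ).of_isometryEquiv e,
      (hasWittSign_congr e).1 ((hasWittSign_hyperbolicSum (by simp)).2 h)⟩

theorem exists_isPlusQuad [Finite F] {n : ℕ} (hn : Even n) :
    ∃ Q : QuadraticForm F (Fin n → F), IsNonsingularQuad Q ∧ IsPlusQuad Q := by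
  obtain ⟨m, rfl⟩ := hn
  rw [← two_mul]
  obtain ⟨Q, hQ, h⟩ := exists_hasWittSign_one F m
  exact ⟨Q, hQ, (isPlusQuad_iff_hasWittSign m Q (by simp) hQ).2 h⟩

theorem exists_not_isPlusQuad [Finite F] {n : ℕ} (hn : Even n) (hn0 : n ≠ 0) :
    ∃ Q : QuadraticForm F (Fin n → F), IsNonsingularQuad Q ∧ ¬ IsPlusQuad Q := by
  obtain ⟨m, rfl⟩ := hn
  rw [← two_mul]
  obtain ⟨m, rfl⟩ := Nat.exists_eq_succ_of_ne_zero (show m ≠ 0 by omega)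
  obtain ⟨Q, hQ, h⟩ := exists_hasWittSign_neg_one F m
  exact ⟨Q, hQ, fun hp => ((isPlusQuad_iff_hasWittSign _ Q (by simp) hQ).1 hp).unique h⟩

theorem exists_isNonsingularQuad_of_odd {n : ℕ} (hn : Odd n) :
    ∃ Q : QuadraticForm F (Fin n → F), IsNonsingularQuad Q := by
  obtain ⟨k, rfl⟩ := hn
  induction k with
  | zero =>
    obtain ⟨Q', ⟨e⟩⟩ := exists_isometryEquiv_fin (QuadraticMap.sq (R := F)) (n := 2 * 0 + 1)
      (by simp)
    exact ⟨Q', (isNonsingularQuad_of_anisotropic fun v hv => by simpa using hv).of_isometryEquiv e⟩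
  | succ k ih =>
    obtain ⟨Q, hQ⟩ := ih
    obtain ⟨Q', ⟨e⟩⟩ := exists_hyperbolicSum_fin Q
    exact ⟨Q', (isNonsingularQuad_hyperbolicSum.2 hQ).of_isometryEquiv e⟩

/-- Needed for symplectic forms: in characteristic 2, nonsingularity of `Q` alone does not make the
polar form nondegenerate, but a sum of hyperbolic planes does. -/
theorem exists_polar_separating (k : ℕ) :
    ∃ Q : QuadraticForm F (Fin (2 * k) → F), ∀ v, (∀ w, polar Q v w = 0) → v = 0 := by
  induction k with
  | zero => exact ⟨0, fun v _ => funext fun i => absurd i.2 (by omega)⟩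
  | succ k ih =>
    obtain ⟨Q, hQ⟩ := ih
    obtain ⟨Q', ⟨e⟩⟩ := exists_hyperbolicSum_fin Q
    refine ⟨Q', fun v hv => ?_⟩
    obtain ⟨⟨x, y, v⟩, rfl⟩ := e.toLinearEquiv.surjective v
    have hp : ∀ p, polar (hyperbolicSum Q) (x, y, v) p = 0 := fun p =>
      (polar_isometryEquiv e (x, y, v) p).symm.trans (hv (e p))
    have hx : x = 0 := by simpa using hp (0, 1, 0)
    have hy : y = 0 := by simpa using hp (1, 0, 0)
    have h0 : v = 0 := hQ v fun w => by simpa using hp (0, 0, w)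
    rw [hx, hy, h0]
    exact map_zero e.toLinearEquiv

theorem exists_isSymplecticForm (h2 : ringChar F = 2) {n : ℕ} (hn : Even n) :
    ∃ f : LinearMap.BilinForm F (Fin n → F), IsSymplecticForm f := by
  obtain ⟨k, rfl⟩ := hn
  rw [← two_mul]
  obtain ⟨Q, hQ⟩ := exists_polar_separating F k
  refine ⟨Q.polarBilin, fun v => ?_, hQ, fun v hv => hQ v fun w => ?_⟩
  · rw [polarBilin_apply_apply, polar_self_eq, two_eq_zero_of_ringChar_eq_two h2, zero_mul]
  · rw [polar_comm]
    exact hv w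

end Existence

/-! ### Symmetric bilinear forms as quadratic forms when 2 is invertible -/

section OddCharacteristic

open Module QuadraticMap

variable {F V V' : Type*} [Field F] [AddCommGroup V] [Module F V] [AddCommGroup V'] [Module F V']

theorem polar_toQuadraticMap_of_isSymm {f : LinearMap.BilinForm F V} (hf : f.IsSymm) (u v : V) :
    polar (LinearMap.BilinMap.toQuadraticMap f) u v = 2 * f u v := by
  rw [LinearMap.BilinMap.polar_toQuadraticMap, hf.eq v u, two_mul]

theorem isNonsingularQuad_toQuadraticMap (h2 : (2 : F) ≠ 0) {f : LinearMap.BilinForm F V}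
    (hf : IsOrthogonalForm f) : IsNonsingularQuad (LinearMap.BilinMap.toQuadraticMap f) := by
  rw [isNonsingularQuad_iff]
  intro v _ h
  refine hf.2.1 v fun w => ?_
  have := h w
  rw [polar_toQuadraticMap_of_isSymm hf.1] at this
  exact (mul_eq_zero.1 this).resolve_left h2

theorem bilinIsometryGroup_eq (h2 : (2 : F) ≠ 0) {f : LinearMap.BilinForm F V} (hf : f.IsSymm) :
    bilinIsometryGroup f = quadIsometryGroup (LinearMap.BilinMap.toQuadraticMap f) := by
  ext g
  refine ⟨fun h v => h v v, fun h u v => ?_⟩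
  apply mul_left_cancel₀ h2
  rw [← polar_toQuadraticMap_of_isSymm hf, ← polar_toQuadraticMap_of_isSymm hf, polar, polar,
    ← map_add, h, h, h]

theorem isPlusBilin_iff (h2 : (2 : F) ≠ 0) {f : LinearMap.BilinForm F V} (hf : f.IsSymm) :
    IsPlusBilin f ↔ IsPlusQuad (LinearMap.BilinMap.toQuadraticMap f) := by
  refine exists_congr fun W => and_congr_right fun _ =>
    ⟨fun h w hw => h w hw w hw, fun h u hu w hw => ?_⟩
  apply mul_left_cancel₀ h2
  rw [← polar_toQuadraticMap_of_isSymm hf, polar, h _ (W.add_mem hu hw), h _ hu, h _ hw]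
  simp

/-- In odd characteristic the polar form of a nonsingular quadratic form is an orthogonal form of
the same type. -/
theorem isOrthogonalForm_polarBilin (h2 : (2 : F) ≠ 0) {Q : QuadraticForm F V}
    (hQ : IsNonsingularQuad Q) :
    IsOrthogonalForm Q.polarBilin ∧ (IsPlusBilin Q.polarBilin ↔ IsPlusQuad Q) := by
  have hsep : ∀ v, (∀ w, polar Q v w = 0) → v = 0 := fun v h => by
    refine isNonsingularQuad_iff.1 hQ v ?_ h
    have := h v
    rw [polar_self_eq] at this
    exact (mul_eq_zero.1 this).resolve_left h2
  refine ⟨⟨⟨fun u v => polar_comm Q u v⟩, hsep, fun v hv => hsep v fun w => ?_⟩, ?_⟩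
  · rw [polar_comm]
    exact hv w
  · refine exists_congr fun W => and_congr_right fun _ => ⟨fun h w hw => ?_, fun h u hu w hw => ?_⟩
    · have := h w hw w hw
      rw [polarBilin_apply_apply, polar_self_eq] at this
      exact (mul_eq_zero.1 this).resolve_left h2
    · rw [polarBilin_apply_apply, polar, h _ (W.add_mem hu hw), h _ hu, h _ hw]
      simp

end OddCharacteristic

/-! ### Symplectic groups as orthogonal groups in characteristic 2 -/

section CharacteristicTwo

open Module QuadraticMap

variable {F W : Type*} [Field F] [AddCommGroup W] [Module F W]

/-- In characteristic two every alternating form is the polar form of a quadratic form. -/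
theorem exists_polar_eq_of_isAlt [FiniteDimensional F W] (h2 : (2 : F) = 0)
    {f : LinearMap.BilinForm F W} (hf : f.IsAlt) :
    ∃ q : QuadraticForm F W, ∀ u v, polar q u v = f u v := by
  let b := finBasis F W
  -- The strict upper triangle of the Gram matrix: adding its transpose restores `f`, which has zero
  -- diagonal and satisfies `-1 = 1`.
  let B : LinearMap.BilinForm F W :=
    Matrix.toBilin b (Matrix.of fun i j => if i < j then f (b i) (b j) else 0)
  have hB : ∀ i j, B (b i) (b j) = if i < j then f (b i) (b j) else 0 := fun i j => by
    rw [← LinearMap.BilinForm.toMatrix_apply b B, LinearMap.BilinForm.toMatrix_toBilin]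
    rfl
  have key : B + B.flip = f := by
    refine LinearMap.BilinForm.ext_basis b fun i j => ?_
    rw [LinearMap.add_apply, LinearMap.add_apply, LinearMap.BilinForm.flip_apply, hB, hB]
    rcases lt_trichotomy i j with h | h | h
    · simp [h, h.not_gt]
    · subst h
      simp [hf (b i)]
    · have := LinearMap.BilinForm.IsAlt.neg_eq hf (b i) (b j)
      simp only [h, h.not_gt, if_false, if_true, zero_add]
      linear_combination (-f (b i) (b j)) * h2 - this
  refine ⟨LinearMap.BilinMap.toQuadraticMap B, fun u v => ?_⟩
  rw [LinearMap.BilinMap.polar_toQuadraticMap, ← key]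
  rfl

theorem eq_of_sq_eq_sq_of_two_eq_zero (h2 : (2 : F) = 0) {a b : F} (h : a ^ 2 = b ^ 2) :
    a = b := by
  have : (a - b) ^ 2 = 0 := by linear_combination h + (b ^ 2 - a * b) * h2
  exact sub_eq_zero.1 (pow_eq_zero_iff two_ne_zero |>.1 this)

theorem isNonsingularQuad_prod_sq {f : LinearMap.BilinForm F W}
    (hf : IsSymplecticForm f) {q : QuadraticForm F W} (hq : ∀ u v, polar q u v = f u v) :
    IsNonsingularQuad (q.prod (QuadraticMap.sq (R := F))) := by
  rw [isNonsingularQuad_iff]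
  rintro ⟨w, t⟩ h hp
  have hw : w = 0 := hf.2.1 w fun v => by
    have := hp (v, 0)
    simp only [polar, prod_apply, Prod.fst_add, Prod.snd_add, sq_apply] at this
    rw [← hq, polar]
    linear_combination this
  subst hw
  have : t = 0 := by simpa using h
  simp [this]

/-- For `σ` preserving the polar form of `q`, the function `q - q ∘ σ` is the square of a linear
form in characteristic two. -/
theorem exists_linear_sq_eq [Finite F] (hF : ringChar F = 2) {f : LinearMap.BilinForm F W}
    {q : QuadraticForm F W} (hq : ∀ u v, polar q u v = f u v) (σ : bilinIsometryGroup f) :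
    ∃ l : W →ₗ[F] F, ∀ w, l w ^ 2 = q w - q (σ.1 w) := by
  have h2 := two_eq_zero_of_ringChar_eq_two hF
  -- Square roots exist and are unique. As `σ` preserves the polar form, `q - q ∘ σ` is additive, so
  -- its square root is linear.
  choose r hr using fun a : F => FiniteField.isSquare_of_char_two hF a
  have hr2 : ∀ a, r a ^ 2 = a := fun a => by rw [pow_two, ← hr]
  refine ⟨⟨⟨fun w => r (q w - q (σ.1 w)), fun v w => ?_⟩, fun c w => ?_⟩, fun w => hr2 _⟩
  · apply eq_of_sq_eq_sq_of_two_eq_zero h2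
    have e1 := hq v w
    have e2 := hq (σ.1 v) (σ.1 w)
    rw [σ.2 v w, ← e1, polar, polar, ← map_add] at e2
    rw [add_sq, hr2, hr2, hr2]
    linear_combination -e2 - r (q v - q (σ.1 v)) * r (q w - q (σ.1 w)) * h2
  · apply eq_of_sq_eq_sq_of_two_eq_zero h2
    rw [RingHom.id_apply, smul_eq_mul, mul_pow, hr2, hr2, LinearEquiv.map_smul, QuadraticMap.map_smul,
      QuadraticMap.map_smul]
    simp only [smul_eq_mul]
    ring

/-- The symplectic group of the polar form of `q` is the orthogonal group of the sum of `q` and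
the square form on a line. -/
theorem nonempty_mulEquiv_prod_sq [Finite F] [FiniteDimensional F W] (hF : ringChar F = 2)
    {f : LinearMap.BilinForm F W} (hf : IsSymplecticForm f) {q : QuadraticForm F W}
    (hq : ∀ u v, polar q u v = f u v) :
    Nonempty (bilinIsometryGroup f ≃* quadIsometryGroup (q.prod (QuadraticMap.sq (R := F)))) := by
  have h2 := two_eq_zero_of_ringChar_eq_two hF
  choose l hl using exists_linear_sq_eq hF hq
  let R := q.prod (QuadraticMap.sq (R := F))
  have hR : ∀ p, R p = q p.1 + p.2 ^ 2 := fun p => by simp [R, pow_two]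
  have hlmul : ∀ σ τ w, l (σ * τ) w = l τ w + l σ (τ.1 w) := fun σ τ w => by
    apply eq_of_sq_eq_sq_of_two_eq_zero h2
    rw [add_sq, hl, hl, hl]
    change q w - q (σ.1 (τ.1 w)) = _
    linear_combination (-l τ w * l σ (τ.1 w)) * h2
  -- The defect `q w - q (σ w)` is compensated by adding its square root `l σ w` to the line
  -- coordinate; the cocycle rule `hlmul` makes this multiplicative.
  let φ : bilinIsometryGroup f → quadIsometryGroup R := fun σ =>
    ⟨{ toFun := fun p => (σ.1 p.1, p.2 + l σ p.1)
       invFun := fun p => (σ.1.symm p.1, p.2 - l σ (σ.1.symm p.1))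
       left_inv := fun p => by simp
       right_inv := fun p => by simp
       map_add' := fun p r => by
        ext
        · simp
        · simp
          ring
       map_smul' := fun c p => by
        ext
        · simp
        · simp
          ring }, fun p => by
      rw [hR, hR]
      change q (σ.1 p.1) + (p.2 + l σ p.1) ^ 2 = _
      rw [add_sq, hl]
      linear_combination p.2 * l σ p.1 * h2⟩
  have hφ : ∀ σ p, (φ σ).1 p = (σ.1 p.1, p.2 + l σ p.1) := fun σ p => rfl
  have hmul : ∀ σ τ, φ (σ * τ) = φ σ * φ τ := fun σ τ => by
    refine Subtype.ext (LinearEquiv.ext fun p => ?_)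
    change (φ (σ * τ)).1 p = (φ σ).1 ((φ τ).1 p)
    rw [hφ, hφ, hφ, hlmul, ← add_assoc]
    rfl
  have hinj : Function.Injective φ := fun σ τ h => by
    refine Subtype.ext (LinearEquiv.ext fun w => ?_)
    have := congrArg (fun g : quadIsometryGroup R => (g.1 (w, 0)).1) h
    exact this
  have hsurj : Function.Surjective φ := fun g => by
    have hpR : ∀ p r, polar R p r = f p.1 r.1 := fun p r => by
      rw [← hq, polar, polar, hR, hR, hR]
      simp only [Prod.fst_add, Prod.snd_add]
      linear_combination p.2 * r.2 * h2
    have hg : ∀ p r, f (g.1 p).1 (g.1 r).1 = f p.1 r.1 := fun p r => by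
      rw [← hpR, ← hpR, polar, polar, ← map_add, g.2, g.2, g.2]
    -- The line is the radical of the polar form of `R`, so `g` preserves it, and `t²` determines
    -- `t`.
    have hline : ∀ t, g.1 (0, t) = (0, t) := fun t => by
      have h1 : (g.1 (0, t)).1 = 0 := hf.2.1 _ fun w => by
        have := hg (0, t) (g.1.symm (w, 0))
        simpa using this
      have h3 := g.2 (0, t)
      rw [hR, hR, h1] at h3
      exact Prod.ext h1 (eq_of_sq_eq_sq_of_two_eq_zero h2 (by simpa using h3))
    let s : W →ₗ[F] W := (LinearMap.fst F W F).comp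
      (g.1.toLinearMap.comp (LinearMap.inl F W F))
    have hs : ∀ w, s w = (g.1 (w, 0)).1 := fun w => rfl
    have hsinj : Function.Injective s := by
      rw [injective_iff_map_eq_zero]
      intro w hw
      refine hf.2.1 w fun v => ?_
      have := hg (w, 0) (v, 0)
      rw [← hs, hw] at this
      simpa using this.symm
    let σ : bilinIsometryGroup f := ⟨LinearEquiv.ofInjectiveEndo s hsinj,
      fun u v => hg (u, 0) (v, 0)⟩
    refine ⟨σ, Subtype.ext (LinearEquiv.ext fun p => ?_)⟩
    have hp : p = (p.1, 0) + (0, p.2) := by simp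
    -- Preservation of `R` determines the square of the second coordinate, hence the coordinate
    -- itself.
    have hw : g.1 (p.1, 0) = (σ.1 p.1, l σ p.1) := by
      refine Prod.ext rfl (eq_of_sq_eq_sq_of_two_eq_zero h2 ?_)
      have h3 := g.2 (p.1, 0)
      rw [hR, hR] at h3
      rw [hl]
      change _ = q p.1 - q (g.1 (p.1, 0)).1
      simp only at h3
      linear_combination h3
    conv_rhs => rw [hp, map_add, hw, hline]
    rw [hφ]
    simp [add_comm]
  exact ⟨MulEquiv.ofBijective (MonoidHom.mk' φ hmul) ⟨hinj, hsurj⟩⟩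

end CharacteristicTwo

/-! ### The four cases -/

theorem theorem1 (F : Type*) [Field F] [Finite F] (n : ℕ) (hn : 2 ≤ n) :
    -- odd characteristic, odd dimension: exactly one orthogonal group
    (ringChar F ≠ 2 → Odd n →
      (∃ f : LinearMap.BilinForm F (Fin n → F), IsOrthogonalForm f) ∧
      ∀ (V : Type*) [AddCommGroup V] [Module F V] (V' : Type*) [AddCommGroup V'] [Module F V']
        (f : LinearMap.BilinForm F V) (f' : LinearMap.BilinForm F V'),
        Module.finrank F V = n → Module.finrank F V' = n →
        IsOrthogonalForm f → IsOrthogonalForm f' →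
        Nonempty (bilinIsometryGroup f ≃* bilinIsometryGroup f')) ∧
    -- odd characteristic, even dimension: exactly two orthogonal groups, one for each type
    (ringChar F ≠ 2 → Even n →
      (∃ f : LinearMap.BilinForm F (Fin n → F), IsOrthogonalForm f ∧ IsPlusBilin f) ∧
      (∃ f : LinearMap.BilinForm F (Fin n → F), IsOrthogonalForm f ∧ ¬ IsPlusBilin f) ∧
      ∀ (V : Type*) [AddCommGroup V] [Module F V] (V' : Type*) [AddCommGroup V'] [Module F V']
        (f : LinearMap.BilinForm F V) (f' : LinearMap.BilinForm F V'),
        Module.finrank F V = n → Module.finrank F V' = n →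
        IsOrthogonalForm f → IsOrthogonalForm f' →
        (Nonempty (bilinIsometryGroup f ≃* bilinIsometryGroup f') ↔
          (IsPlusBilin f ↔ IsPlusBilin f'))) ∧
    -- characteristic two, odd dimension: every orthogonal group is the symplectic group `Sp(n - 1)`
    (ringChar F = 2 → Odd n →
      (∃ Q : QuadraticForm F (Fin n → F), IsNonsingularQuad Q) ∧
      (∃ f : LinearMap.BilinForm F (Fin (n - 1) → F), IsSymplecticForm f) ∧
      ∀ (V : Type*) [AddCommGroup V] [Module F V] (W : Type*) [AddCommGroup W] [Module F W]
        (Q : QuadraticForm F V) (f : LinearMap.BilinForm F W),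
        Module.finrank F V = n → Module.finrank F W = n - 1 →
        IsNonsingularQuad Q → IsSymplecticForm f →
        Nonempty (quadIsometryGroup Q ≃* bilinIsometryGroup f)) ∧
    -- characteristic two, even dimension: exactly two orthogonal groups, one for each type
    (ringChar F = 2 → Even n →
      (∃ Q : QuadraticForm F (Fin n → F), IsNonsingularQuad Q ∧ IsPlusQuad Q) ∧
      (∃ Q : QuadraticForm F (Fin n → F), IsNonsingularQuad Q ∧ ¬ IsPlusQuad Q) ∧
      ∀ (V : Type*) [AddCommGroup V] [Module F V] (V' : Type*) [AddCommGroup V'] [Module F V']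
        (Q : QuadraticForm F V) (Q' : QuadraticForm F V'),
        Module.finrank F V = n → Module.finrank F V' = n →
        IsNonsingularQuad Q → IsNonsingularQuad Q' →
        (Nonempty (quadIsometryGroup Q ≃* quadIsometryGroup Q') ↔
          (IsPlusQuad Q ↔ IsPlusQuad Q'))) := by
  refine ⟨fun hF hodd => ?_, fun hF heven => ?_, fun hF hodd => ?_, fun hF heven => ?_⟩
  · have h2 : (2 : F) ≠ 0 := fun h => hF (ringChar_eq_two_of_two_eq_zero h)
    refine ⟨?_, ?_⟩
    · obtain ⟨Q, hQ⟩ := exists_isNonsingularQuad_of_odd F hodd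
      exact ⟨_, (isOrthogonalForm_polarBilin h2 hQ).1⟩
    · intro V _ _ V' _ _ f f' hV hV' hf hf'
      obtain ⟨k, rfl⟩ := hodd
      obtain ⟨e, c, hc, he⟩ := exists_similitude_of_odd_finrank k _ _ hV hV'
        (isNonsingularQuad_toQuadraticMap h2 hf) (isNonsingularQuad_toQuadraticMap h2 hf')
      rw [bilinIsometryGroup_eq h2 hf.1, bilinIsometryGroup_eq h2 hf'.1]
      exact ⟨quadIsometryGroupCongr e hc he⟩
  · have h2 : (2 : F) ≠ 0 := fun h => hF (ringChar_eq_two_of_two_eq_zero h)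
    refine ⟨?_, ?_, ?_⟩
    · obtain ⟨Q, hQ, hp⟩ := exists_isPlusQuad F heven
      have h := isOrthogonalForm_polarBilin h2 hQ
      exact ⟨_, h.1, h.2.2 hp⟩
    · obtain ⟨Q, hQ, hp⟩ := exists_not_isPlusQuad F heven (by omega)
      have h := isOrthogonalForm_polarBilin h2 hQ
      exact ⟨_, h.1, fun hb => hp (h.2.1 hb)⟩
    · intro V _ _ V' _ _ f f' hV hV' hf hf'
      have : FiniteDimensional F V := Module.finite_of_finrank_pos (by omega)
      have : FiniteDimensional F V' := Module.finite_of_finrank_pos (by omega)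
      rw [bilinIsometryGroup_eq h2 hf.1, bilinIsometryGroup_eq h2 hf'.1, isPlusBilin_iff h2 hf.1,
        isPlusBilin_iff h2 hf'.1]
      exact nonempty_mulEquiv_iff_isPlusQuad_iff heven hV hV'
        (isNonsingularQuad_toQuadraticMap h2 hf) (isNonsingularQuad_toQuadraticMap h2 hf')
  · have h2 := two_eq_zero_of_ringChar_eq_two hF
    refine ⟨exists_isNonsingularQuad_of_odd F hodd,
      exists_isSymplecticForm F hF (Nat.Odd.sub_odd hodd odd_one), ?_⟩
    intro V _ _ W _ _ Q f hV hW hQ hf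
    -- An odd `n ≥ 2` is at least 3, so `n - 1` is positive and not the default value of `finrank`.
    have : FiniteDimensional F W := Module.finite_of_finrank_pos (by omega)
    obtain ⟨q, hq⟩ := exists_polar_eq_of_isAlt h2 hf.1
    obtain ⟨φ⟩ := nonempty_mulEquiv_prod_sq hF hf hq
    obtain ⟨k, rfl⟩ := hodd
    obtain ⟨e, c, hc, he⟩ := exists_similitude_of_odd_finrank k Q _ hV
      (by rw [Module.finrank_prod, hW, Module.finrank_self]; omega) hQ
      (isNonsingularQuad_prod_sq hf hq)
    exact ⟨(quadIsometryGroupCongr e hc he).trans φ.symm⟩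
  · refine ⟨exists_isPlusQuad F heven, exists_not_isPlusQuad F heven (by omega), ?_⟩
    intro V _ _ V' _ _ Q Q' hV hV' hQ hQ'
    have : FiniteDimensional F V := Module.finite_of_finrank_pos (by omega)
    have : FiniteDimensional F V' := Module.finite_of_finrank_pos (by omega)
    exact nonempty_mulEquiv_iff_isPlusQuad_iff heven hV hV' hQ hQ'
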